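/- Let $n\ge 1$ and let $M\in \mathrm{SL}(2n+1,\mathbb Z)$ have a real eigenvalue $\alpha>0$, $\alpha\neq 1$, which is a simple root of the characteristic polynomial, all other eigenvalues of $M$ being non-real. Let $a\in\mathbb R^{2n+1}$ be a real eigenvector of $M$ for $\alpha$, let $W\subset\mathbb C^{2n+1}$ be the sum of the generalized eigenspaces of $M$ for the eigenvalues with positive imaginary part, let $b_1,\dots,b_n$ be a basis of $W$, and let $R=(r_{\ell j})$ be the matrix of $M|_W$ in this basis, $Mb_j=\sum_{\ell} r_{\ell j}b_\ell$. Write $\mathbb H$ for the upper half-plane, let $G_M$ be the group of automorphisms of $\mathbb H\times\mathbb C^n$ generated by $$g_0(w,z)=(\alpha w,R^{\top}z),\qquad g_i(w,z)=\bigl(w+a^{(i)},\,z+(b_1^{(i)},\dots,b_n^{(i)})^{\top}\bigr)\quad(1\le i\le 2n+1),$$ where the superscript $(i)$ denotes the $i$-th coordinate, and let $T_M=(\mathbb H\times\mathbb C^n)/G_M$ be the quotient complex manifold (the action of $G_M$ is free and properly discontinuous). Then: 1. There are no non-zero holomorphic 1-forms on $T_M$. 2. Let $K=K_{T_M}=\bigwedge^{n+1}T^*T_M$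 be the canonical bundle. For every integer $k\geq 1$ the bundle $K^{\otimes k}$ has no non-zero global holomorphic sections. Consequently the Kodaira dimension of $T_M$ is $-\infty$. -/

import Mathlib

open scoped Manifold UpperHalfPlane ContDiff TensorProduct Topology Matrix

noncomputable section

/-! ### Holomorphic forms, pluricanonical sections and Kodaira dimension of a complex manifold -/

namespace ComplexManifold

variable {E : Type*} [NormedAddCommGroup E] [NormedSpace ℂ E]
  {H : Type*} [TopologicalSpace H] (I : ModelWithCorners ℂ E H)
  {X : Type*} [TopologicalSpace X] [ChartedSpace H X]

/-- A field `l` of complex linear forms on the tangent spaces of the complex manifold `X` is a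
holomorphic 1-form if it is a holomorphic (that is, complex differentiable) section of the
cotangent bundle. -/
def IsHolomorphicOneForm [IsManifold I 1 X] (l : ∀ x : X, TangentSpace I x →L[ℂ] ℂ) : Prop :=
  MDifferentiable I (I.prod 𝓘(ℂ, E →L[ℂ] ℂ))
    (fun x ↦ (⟨x, l x⟩ : Bundle.TotalSpace (E →L[ℂ] ℂ)
      (fun x : X ↦ TangentSpace I x →L[ℂ] Bundle.Trivial X ℂ x)))

/-- The fibre at `x` of the canonical bundle `K = ⋀ᵐ T*X`, `m = dim X`: the alternating
`m`-forms on the tangent space at `x`. -/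
abbrev CanonicalFiber (x : X) : Type _ :=
  TangentSpace I x [⋀^Fin (Module.finrank ℂ E)]→ₗ[ℂ] ℂ

/-- The fibre at `x` of `K^{⊗ k}`. -/
abbrev PluricanonicalFiber (k : ℕ) (x : X) : Type _ :=
  ⨂[ℂ]^k (CanonicalFiber I x)

variable [FiniteDimensional ℂ E]

/-- The form `dz₁ ∧ ⋯ ∧ dz_m` in the coordinates `z₁, …, z_m` given by the chart at `x₀` and
a basis of the model space; it is used at points `x` of the domain of that chart. -/
def coordVolume (x₀ x : X) : CanonicalFiber I x :=
  AlternatingMap.compLinearMap (Module.finBasis ℂ E).det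
    (mfderiv I 𝓘(ℂ, E) (extChartAt I x₀) x : TangentSpace I x →L[ℂ] E).toLinearMap

/-- The space `H⁰(X, K^{⊗ k})` of holomorphic sections of `K^{⊗ k}`: on the domain of each
coordinate chart the section is `f (dz₁ ∧ ⋯ ∧ dz_m)^{⊗ k}` with `f` a holomorphic function
of the coordinates. -/
def pluricanonicalSections (X : Type*) [TopologicalSpace X] [ChartedSpace H X] (k : ℕ) :
    Submodule ℂ (∀ x : X, PluricanonicalFiber I k x) where
  carrier := {s | ∀ x₀ : X, ∃ f : E → ℂ, DifferentiableOn ℂ f (extChartAt I x₀).target ∧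
    ∀ x ∈ (extChartAt I x₀).source,
      s x = f (extChartAt I x₀ x) • PiTensorProduct.tprod ℂ (fun _ : Fin k ↦ coordVolume I x₀ x)}
  add_mem' := by
    intro s t hs ht x₀
    obtain ⟨f, hf, hsf⟩ := hs x₀
    obtain ⟨g, hg, htg⟩ := ht x₀
    refine ⟨f + g, hf.add hg, fun x hx ↦ ?_⟩
    rw [Pi.add_apply, hsf x hx, htg x hx, Pi.add_apply, add_smul]
  zero_mem' := fun x₀ ↦ ⟨0, differentiableOn_const 0, fun x _ ↦ by simp⟩
  smul_mem' := by
    intro c s hs x₀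
    obtain ⟨f, hf, hsf⟩ := hs x₀
    refine ⟨c • f, hf.const_smul c, fun x hx ↦ ?_⟩
    rw [Pi.smul_apply, hsf x hx, Pi.smul_apply, smul_smul, smul_eq_mul]

/-- The plurigenus `P_k = dim H⁰(X, K^{⊗ k})`. -/
def plurigenus (X : Type*) [TopologicalSpace X] [ChartedSpace H X] (k : ℕ) : ℕ∞ :=
  Cardinal.toENat (Module.rank ℂ (pluricanonicalSections I X k))

open Classical in
/-- The Kodaira dimension of a (compact connected) complex manifold: it is `-∞` (that is, `⊥`) if
all plurigenera `P_k`, `k ≥ 1`, vanish, and otherwise the least `d` such that `P_k / k ^ d` is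
bounded. -/
def kodairaDimension (X : Type*) [TopologicalSpace X] [ChartedSpace H X] : WithBot ℕ∞ :=
  if ∀ k : ℕ, 1 ≤ k → plurigenus I X k = 0 then ⊥
  else ((⨅ (d : ℕ) (_ : ∃ C : ℕ, ∀ k : ℕ, 1 ≤ k → plurigenus I X k ≤ C * (k : ℕ∞) ^ d),
    (d : ℕ∞) : ℕ∞) : WithBot ℕ∞)

end ComplexManifold

/-! ### The quotient of a complex manifold by a free properly discontinuous holomorphic action -/

/-- The charts of the quotient are those for which the projection is a local isomorphism; they
are compatible as soon as the group acts by maps of class `C^r`. -/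
theorem isManifold_orbitRel_quotient {𝕜 : Type*} [NontriviallyNormedField 𝕜]
    {E : Type*} [NormedAddCommGroup E] [NormedSpace 𝕜 E]
    {H : Type*} [TopologicalSpace H] (I : ModelWithCorners 𝕜 E H) (r : ℕ∞ω)
    {X : Type*} [TopologicalSpace X] [ChartedSpace H X] [IsManifold I r X]
    {G : Type*} [Group G] [MulAction G X]
    [ProperlyDiscontinuousSMul G X] [ContinuousConstSMul G X] [IsCancelSMul G X]
    [T2Space X] [LocallyCompactSpace X]
    (hG : ∀ g : G, ContMDiff I I r (fun x : X ↦ g • x)) :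
    IsManifold I r (MulAction.orbitRel.Quotient G X) := by
  have hcov : IsLocalHomeomorph (Quotient.mk (MulAction.orbitRel G X)) :=
    (isQuotientCoveringMap_quotientMk_of_properlyDiscontinuousSMul
      (E := X) (G := G)).isCoveringMap.isLocalHomeomorph
  have key : ∀ x y : X, ∀ p ∈ ((hcov.localInverseAt x).trans (chartAt H x)).target,
      ((hcov.localInverseAt x).trans (chartAt H x)).symm p ∈
        ((hcov.localInverseAt y).trans (chartAt H y)).source →
      ContDiffWithinAt 𝕜 r (I ∘ (chartAt H y) ∘ (hcov.localInverseAt y) ∘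
        (Quotient.mk (MulAction.orbitRel G X)) ∘ (chartAt H x).symm ∘ I.symm)
        (Set.range I) (I p) := by
    intro x y p hp hq
    rw [OpenPartialHomeomorph.trans_target] at hp
    rw [OpenPartialHomeomorph.trans_source] at hq
    set u : X := (chartAt H x).symm p with hu
    have hsym : ((hcov.localInverseAt x).trans (chartAt H x)).symm p
        = Quotient.mk (MulAction.orbitRel G X) u := by
      rw [OpenPartialHomeomorph.coe_trans_symm, hcov.localInverseAt_symm]
      rfl
    rw [hsym] at hq
    set v : X := hcov.localInverseAt y (Quotient.mk _ u) with hv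
    have hπ : Quotient.mk (MulAction.orbitRel G X) v = Quotient.mk _ u :=
      hcov.apply_localInverseAt_of_mem hq.1
    obtain ⟨γ, hγ⟩ : ∃ γ : G, γ • u = v := MulAction.orbitRel_apply.1 (Quotient.exact hπ)
    have hvt : v ∈ (hcov.localInverseAt y).target := (hcov.localInverseAt y).map_source hq.1
    have hus : u ∈ (chartAt H x).source := (chartAt H x).map_target hp.1
    have hev : ∀ᶠ u' in 𝓝 u, hcov.localInverseAt y (Quotient.mk _ u') = γ • u' := by
      have hc : Filter.Tendsto (fun u' : X ↦ γ • u') (𝓝 u) (𝓝 v) := by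
        rw [← hγ]; exact (continuous_const_smul γ).continuousAt
      filter_upwards [hc ((hcov.localInverseAt y).open_target.mem_nhds hvt)] with u' hu'
      have h1 : Quotient.mk (MulAction.orbitRel G X) (γ • u') = Quotient.mk _ u' :=
        Quotient.sound (MulAction.orbitRel_apply.2 ⟨γ, rfl⟩)
      have h2 := (hcov.localInverseAt y).right_inv hu'
      rw [hcov.localInverseAt_symm, h1] at h2
      exact h2
    have hcs : ContinuousWithinAt ((chartAt H x).symm ∘ I.symm) (Set.range I) (I p) := by
      apply ContinuousAt.continuousWithinAt
      refine ContinuousAt.comp ?_ I.continuous_symm.continuousAt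
      rw [I.left_inv]
      exact (chartAt H x).continuousAt_symm hp.1
    have hval : ((chartAt H x).symm ∘ I.symm) (I p) = u := by simp [hu]
    have hev' : ∀ᶠ q in 𝓝[Set.range I] (I p),
        hcov.localInverseAt y (Quotient.mk _ (((chartAt H x).symm ∘ I.symm) q))
          = γ • (((chartAt H x).symm ∘ I.symm) q) := by
      have := hcs.tendsto
      rw [hval] at this
      exact this.eventually hev
    have hsm : ContMDiffAt I I r (fun u : X ↦ γ • u) u := (hG γ).contMDiffAt
    have hvs : γ • u ∈ (chartAt H y).source := by rw [hγ]; exact hq.2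
    rw [contMDiffAt_iff_of_mem_source hus hvs] at hsm
    have h3 := hsm.2
    have h4 : extChartAt I x u = I p := by
      simp [extChartAt, hu, (chartAt H x).right_inv hp.1]
    rw [h4] at h3
    refine h3.congr_of_eventuallyEq ?_ ?_
    · filter_upwards [hev'] with q hq'
      simp only [Function.comp_apply] at hq' ⊢
      rw [hq']
      rfl
    · have := hev'.self_of_nhdsWithin ⟨p, rfl⟩
      simp only [Function.comp_apply] at this ⊢
      rw [this]
      rfl
  apply isManifold_of_contDiffOn
  intro e e' he he'
  obtain ⟨q, rfl⟩ := he
  obtain ⟨q', rfl⟩ := he'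
  rintro _ ⟨hp, p, rfl⟩
  simp only [Set.mem_preimage, I.left_inv, OpenPartialHomeomorph.trans_source,
    OpenPartialHomeomorph.symm_source] at hp
  refine ((key _ _ p hp.1 (by simpa using hp.2)).mono Set.inter_subset_right).congr ?_ ?_
  · intro z hz
    simp only [Function.comp_apply, OpenPartialHomeomorph.coe_trans,
      OpenPartialHomeomorph.coe_trans_symm, hcov.localInverseAt_symm]
  · simp only [Function.comp_apply, OpenPartialHomeomorph.coe_trans,
      OpenPartialHomeomorph.coe_trans_symm, hcov.localInverseAt_symm]

/-! ### The manifold `T_M` -/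

/-- The sum of the generalized eigenspaces of a complex matrix for the
eigenvalues with positive imaginary part. -/
def upperEigenspace {m : ℕ} (A : Matrix (Fin m) (Fin m) ℂ) : Submodule ℂ (Fin m → ℂ) :=
  ⨆ β : {β : ℂ // 0 < β.im}, Module.End.maxGenEigenspace (Matrix.toLin' A) β

theorem mapsTo_upperEigenspace {m : ℕ} (A : Matrix (Fin m) (Fin m) ℂ) :
    ∀ x ∈ upperEigenspace A, Matrix.toLin' A x ∈ upperEigenspace A := by
  suffices h : upperEigenspace A ≤ (upperEigenspace A).comap (Matrix.toLin' A) from h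
  refine iSup_le fun β x hx ↦ ?_
  exact (le_iSup (fun β : {β : ℂ // 0 < β.im} ↦
    Module.End.maxGenEigenspace (Matrix.toLin' A) (β : ℂ)) β)
    (Module.End.mapsTo_maxGenEigenspace_of_comm (Commute.refl _) _ hx)

/-- The data from which `T_M` is built: a matrix `M ∈ SL(2n+1, ℤ)` with a simple real eigenvalue
`α > 0`, `α ≠ 1`, whose other eigenvalues are not real, a real eigenvector `a` for `α`, and a
basis `b` of the sum `W` of the generalized eigenspaces for the eigenvalues with positive
imaginary part. -/
structure InoueData (n : ℕ) where
  /-- the matrix `M` -/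
  M : Matrix.SpecialLinearGroup (Fin (2 * n + 1)) ℤ
  /-- the real eigenvalue -/
  α : ℝ
  α_pos : 0 < α
  α_ne_one : α ≠ 1
  α_simple : (M.1.map (Int.cast : ℤ → ℂ)).charpoly.rootMultiplicity (α : ℂ) = 1
  im_ne_zero : ∀ μ : ℂ, (M.1.map (Int.cast : ℤ → ℂ)).charpoly.IsRoot μ → μ ≠ α → μ.im ≠ 0
  /-- the real eigenvector -/
  a : Fin (2 * n + 1) → ℝ
  a_ne_zero : a ≠ 0
  mulVec_a : M.1.map (Int.cast : ℤ → ℝ) *ᵥ a = α • a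
  /-- the basis of `W` -/
  b : Module.Basis (Fin n) ℂ (upperEigenspace (M.1.map (Int.cast : ℤ → ℂ)))

namespace InoueData

variable {n : ℕ} (D : InoueData n)

/-- `M` as a complex matrix. -/
abbrev MC : Matrix (Fin (2 * n + 1)) (Fin (2 * n + 1)) ℂ := D.M.1.map (Int.cast : ℤ → ℂ)

/-- The restriction of `M` to `W`. -/
def fM : upperEigenspace D.MC →ₗ[ℂ] upperEigenspace D.MC :=
  (Matrix.toLin' D.MC).restrict (mapsTo_upperEigenspace D.MC)

/-- The matrix of the restriction of `M` to `W` in the basis `b`: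
`M b_j = ∑ l, R l j • b_l`. -/
def R : Matrix (Fin n) (Fin n) ℂ := LinearMap.toMatrix D.b D.b D.fM

/-- The vector `b^{(i)} = (b_1^{(i)}, …, b_n^{(i)})` of the `i`-th coordinates of the basis. -/
def bvec (i : Fin (2 * n + 1)) : Fin n → ℂ := fun j ↦ (D.b j : Fin (2 * n + 1) → ℂ) i

theorem det_MC : D.MC.det = 1 := by
  have h := D.M.2
  have := (Int.castRingHom ℂ).map_det D.M.1
  rw [h, map_one] at this
  exact this.symm

theorem fM_apply (x : upperEigenspace D.MC) : (D.fM x : Fin (2 * n + 1) → ℂ) = D.MC *ᵥ x := rfl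

theorem isUnit_det_R : IsUnit D.R.det := by
  have hinj : Function.Injective D.fM := by
    intro x y hxy
    have h : D.MC *ᵥ (x : Fin (2 * n + 1) → ℂ) = D.MC *ᵥ y := congrArg Subtype.val hxy
    exact Subtype.ext (Matrix.mulVec_injective_of_isUnit
      ((Matrix.isUnit_iff_isUnit_det _).2 (by rw [D.det_MC]; exact isUnit_one)) h)
  have h := LinearEquiv.isUnit_det (LinearEquiv.ofInjectiveEndo D.fM hinj) D.b D.b
  exact h

/-- `g₀ (w, z) = (α w, Rᵀ z)`. -/
def g₀ : Equiv.Perm (ℍ × (Fin n → ℂ)) where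
  toFun p := ((⟨D.α, D.α_pos⟩ : {x : ℝ // 0 < x}) • p.1, D.Rᵀ *ᵥ p.2)
  invFun p := ((⟨D.α⁻¹, inv_pos.2 D.α_pos⟩ : {x : ℝ // 0 < x}) • p.1, D.Rᵀ⁻¹ *ᵥ p.2)
  left_inv p := by
    have h : IsUnit D.Rᵀ.det := by rw [Matrix.det_transpose]; exact D.isUnit_det_R
    refine Prod.ext (UpperHalfPlane.ext ?_) ?_
    · simp [UpperHalfPlane.coe_pos_real_smul, D.α_pos.ne']
    · simp [Matrix.mulVec_mulVec, Matrix.nonsing_inv_mul _ h]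
  right_inv p := by
    have h : IsUnit D.Rᵀ.det := by rw [Matrix.det_transpose]; exact D.isUnit_det_R
    refine Prod.ext (UpperHalfPlane.ext ?_) ?_
    · simp [UpperHalfPlane.coe_pos_real_smul, D.α_pos.ne']
    · simp [Matrix.mulVec_mulVec, Matrix.mul_nonsing_inv _ h]

/-- The translation `g_i (w, z) = (w + a^{(i)}, z + b^{(i)})`. -/
def g (i : Fin (2 * n + 1)) : Equiv.Perm (ℍ × (Fin n → ℂ)) where
  toFun p := (D.a i +ᵥ p.1, p.2 + D.bvec i)
  invFun p := (-D.a i +ᵥ p.1, p.2 - D.bvec i)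
  left_inv p := by simp
  right_inv p := by simp

/-- The group `G_M` of transformations of `ℍ × ℂⁿ` generated by the biholomorphic maps `g₀` and
`g_i`. -/
def GM : Subgroup (Equiv.Perm (ℍ × (Fin n → ℂ))) :=
  Subgroup.closure (insert D.g₀ (Set.range D.g))

/-! The action of `G_M` is free and properly discontinuous. -/

theorem dotProduct_eq_zero (c : Fin (2 * n + 1) → ℝ) (ha : D.a ⬝ᵥ c = 0)
    (hb : ∀ j, (D.b j : Fin (2 * n + 1) → ℂ) ⬝ᵥ (fun i ↦ (c i : ℂ)) = 0)
    (v : Fin (2 * n + 1) → ℂ) : v ⬝ᵥ (fun i ↦ (c i : ℂ)) = 0 := by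
  let φ : (Fin (2 * n + 1) → ℂ) →ₗ[ℂ] ℂ :=
    { toFun := fun v ↦ v ⬝ᵥ (fun i ↦ (c i : ℂ))
      map_add' := fun x y ↦ add_dotProduct _ _ _
      map_smul' := fun r x ↦ smul_dotProduct _ _ _ }
  have hW : upperEigenspace D.MC ≤ LinearMap.ker φ := by
    intro x hx
    have h := D.b.sum_repr ⟨x, hx⟩
    have h' := congrArg (fun y : upperEigenspace D.MC ↦ φ y) h
    simp only [Submodule.coe_sum, Submodule.coe_smul, map_sum, map_smul] at h'
    rw [LinearMap.mem_ker, ← h']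
    exact Finset.sum_eq_zero fun j _ ↦ by
      have : φ (D.b j : Fin (2 * n + 1) → ℂ) = 0 := hb j
      rw [this, smul_zero]
  have hU : ∀ μ : ℂ, 0 < μ.im →
      Module.End.maxGenEigenspace (Matrix.toLin' D.MC) μ ≤ LinearMap.ker φ := fun μ hμ ↦
    (le_iSup (fun β : {β : ℂ // 0 < β.im} ↦
      Module.End.maxGenEigenspace (Matrix.toLin' D.MC) (β : ℂ)) ⟨μ, hμ⟩).trans hW
  suffices h : (⊤ : Submodule ℂ (Fin (2 * n + 1) → ℂ)) ≤ LinearMap.ker φ from h Submodule.mem_top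
  rw [← Module.End.iSup_maxGenEigenspace_eq_top (Matrix.toLin' D.MC)]
  refine iSup_le fun μ ↦ ?_
  have hfin := LinearMap.finrank_maxGenEigenspace_eq (Matrix.toLin' D.MC) μ
  rw [Matrix.charpoly_toLin'] at hfin
  rcases lt_trichotomy μ.im 0 with h | h | h
  · intro v hv
    have hv' : star v ∈ Module.End.maxGenEigenspace (Matrix.toLin' D.MC) (star μ) := by
      rw [Module.End.mem_maxGenEigenspace] at hv ⊢
      obtain ⟨k, hk⟩ := hv
      refine ⟨k, ?_⟩
      have hstep : ∀ x : Fin (2 * n + 1) → ℂ, (Matrix.toLin' D.MC - star μ • 1) (star x)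
          = star ((Matrix.toLin' D.MC - μ • 1) x) := by
        intro x
        ext i
        simp [Matrix.mulVec, dotProduct]
      have hpow : ∀ (k : ℕ) (x : Fin (2 * n + 1) → ℂ),
          ((Matrix.toLin' D.MC - star μ • 1) ^ k) (star x)
          = star (((Matrix.toLin' D.MC - μ • 1) ^ k) x) := by
        intro k
        induction k with
        | zero => intro x; simp
        | succ k ih => intro x; rw [pow_succ, pow_succ, Module.End.mul_apply, hstep, ih]; rfl
      rw [hpow, hk, star_zero]
    have h1 : φ (star v) = 0 := hU (star μ) (by simpa using h) hv'
    have h2 : φ v = star (φ (star v)) := by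
      simp [φ, dotProduct]
    rw [LinearMap.mem_ker, h2, h1, star_zero]
  · by_cases hμ : μ = D.α
    · subst hμ
      rw [D.α_simple] at hfin
      have haV : (fun i ↦ (D.a i : ℂ)) ∈
          Module.End.maxGenEigenspace (Matrix.toLin' D.MC) (D.α : ℂ) := by
        apply Module.End.eigenspace_le_maxGenEigenspace
        rw [Module.End.mem_eigenspace_iff]
        ext i
        have := congrFun D.mulVec_a i
        simp only [Matrix.mulVec, dotProduct, Matrix.map_apply, Pi.smul_apply, smul_eq_mul] at this
        simp only [Matrix.toLin'_apply, Matrix.mulVec, dotProduct, Matrix.map_apply, Pi.smul_apply,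
          smul_eq_mul]
        exact_mod_cast congrArg (Complex.ofReal) this
      intro v hv
      obtain ⟨r, hr⟩ := (finrank_eq_one_iff_of_nonzero'
        (⟨_, haV⟩ : Module.End.maxGenEigenspace (Matrix.toLin' D.MC) (D.α : ℂ)) (by
          intro h0
          apply D.a_ne_zero
          ext i
          have := congrFun (congrArg Subtype.val h0) i
          simpa using this)).1 hfin ⟨v, hv⟩
      have hr' : r • (fun i ↦ (D.a i : ℂ)) = v := congrArg Subtype.val hr
      have h1 : φ (fun i ↦ (D.a i : ℂ)) = 0 := by
        have := congrArg Complex.ofReal ha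
        simpa [φ, dotProduct] using this
      rw [LinearMap.mem_ker, ← hr', map_smul, h1, smul_zero]
    · have hroot : ¬ D.MC.charpoly.IsRoot μ := fun hr ↦ D.im_ne_zero μ hr hμ h
      rw [Polynomial.rootMultiplicity_eq_zero hroot, Submodule.finrank_eq_zero] at hfin
      rw [hfin]
      exact bot_le
  · exact hU μ h

/-- The real linear map `c ↦ ∑ i, c i • u_i` with values in `ℝ × ℂⁿ`. -/
def latticeMap : (Fin (2 * n + 1) → ℝ) →ₗ[ℝ] ℝ × (Fin n → ℂ) where
  toFun c := (∑ i, c i * D.a i, ∑ i, (c i : ℂ) • D.bvec i)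
  map_add' x y := by simp [add_mul, add_smul, Finset.sum_add_distrib]
  map_smul' r x := by
    ext <;> simp [Finset.mul_sum, mul_assoc]

theorem latticeMap_injective : Function.Injective D.latticeMap := by
  rw [← LinearMap.ker_eq_bot, LinearMap.ker_eq_bot']
  intro c hc
  have h1 : ∑ i, c i * D.a i = 0 := congrArg Prod.fst hc
  have h2 : ∑ i, (c i : ℂ) • D.bvec i = 0 := congrArg Prod.snd hc
  have h := D.dotProduct_eq_zero c (by rw [dotProduct_comm]; exact h1) (fun j ↦ by
    have := congrFun h2 j
    simp only [Finset.sum_apply, Pi.smul_apply, smul_eq_mul, bvec, Pi.zero_apply] at this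
    rw [dotProduct_comm]
    exact this)
  ext i
  have := h (Pi.single i 1)
  simpa using this

/-- The translation by an integral combination of the vectors `u_i`. -/
def trans (c : Fin (2 * n + 1) → ℤ) : Equiv.Perm (ℍ × (Fin n → ℂ)) where
  toFun p := ((D.latticeMap (fun i ↦ (c i : ℝ))).1 +ᵥ p.1,
    p.2 + (D.latticeMap (fun i ↦ (c i : ℝ))).2)
  invFun p := (-(D.latticeMap (fun i ↦ (c i : ℝ))).1 +ᵥ p.1,
    p.2 - (D.latticeMap (fun i ↦ (c i : ℝ))).2)
  left_inv p := by simp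
  right_inv p := by simp

theorem trans_apply (c : Fin (2 * n + 1) → ℤ) (p : ℍ × (Fin n → ℂ)) :
    D.trans c p = ((D.latticeMap (fun i ↦ (c i : ℝ))).1 +ᵥ p.1,
      p.2 + (D.latticeMap (fun i ↦ (c i : ℝ))).2) := rfl

theorem trans_add (c c' : Fin (2 * n + 1) → ℤ) : D.trans (c + c') = D.trans c * D.trans c' := by
  ext1 p
  rw [Equiv.Perm.mul_apply, trans_apply, trans_apply, trans_apply]
  have : (fun i ↦ (((c + c') i : ℤ) : ℝ)) = (fun i ↦ (c i : ℝ)) + fun i ↦ (c' i : ℝ) := by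
    ext i; simp
  rw [this, map_add]
  refine Prod.ext ?_ ?_
  · simp [add_vadd]
  · simp only [Prod.snd_add]; abel

theorem trans_zero : D.trans 0 = 1 := by
  ext1 p
  rw [trans_apply]
  have : (fun i ↦ (((0 : Fin (2 * n + 1) → ℤ) i : ℤ) : ℝ)) = 0 := by ext i; simp
  rw [this, map_zero]
  simp

theorem trans_neg (c : Fin (2 * n + 1) → ℤ) : D.trans (-c) = (D.trans c)⁻¹ := by
  rw [eq_inv_iff_mul_eq_one, ← trans_add, neg_add_cancel, trans_zero]

theorem g_eq_trans (i : Fin (2 * n + 1)) : D.g i = D.trans (Pi.single i 1) := by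
  ext1 p
  rw [trans_apply]
  have : (fun j ↦ ((Pi.single i 1 : Fin (2 * n + 1) → ℤ) j : ℝ)) = Pi.single i 1 := by
    ext j; by_cases h : j = i
    · subst h; simp
    · simp [h]
  rw [this]
  have h1 : (D.latticeMap (Pi.single i 1)).1 = D.a i := by
    simp [latticeMap, Pi.single_apply]
  have h2 : (D.latticeMap (Pi.single i 1)).2 = D.bvec i := by
    simp [latticeMap, Pi.single_apply]
  rw [h1, h2]
  rfl

theorem mul_b (i : Fin (2 * n + 1)) :
    D.Rᵀ *ᵥ D.bvec i = ∑ k, (D.M.1 i k : ℂ) • D.bvec k := by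
  ext j
  have h := LinearMap.toMatrix_mulVec_repr D.b D.b D.fM (D.b j)
  have h1 := D.b.sum_repr (D.fM (D.b j))
  have h2 := congrFun (congrArg Subtype.val h1) i
  rw [D.fM_apply] at h2
  have h3 : ∀ l, D.b.repr (D.fM (D.b j)) l = D.R l j := fun l ↦ by
    rw [R, LinearMap.toMatrix_apply]
  simp only [h3, Submodule.coe_sum, Submodule.coe_smul, Finset.sum_apply, Pi.smul_apply,
    smul_eq_mul] at h2
  simp only [Matrix.mulVec, dotProduct, Matrix.transpose_apply, Finset.sum_apply, Pi.smul_apply,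
    smul_eq_mul, bvec]
  rw [h2]
  rfl

theorem latticeMap_vecMul (c : Fin (2 * n + 1) → ℤ) :
    D.latticeMap (fun i ↦ ((c ᵥ* D.M.1) i : ℝ)) =
      (D.α * (D.latticeMap (fun i ↦ (c i : ℝ))).1,
        D.Rᵀ *ᵥ (D.latticeMap (fun i ↦ (c i : ℝ))).2) := by
  refine Prod.ext ?_ ?_
  · have h : ∀ k, ∑ i, (D.M.1 k i : ℝ) * D.a i = D.α * D.a k := fun k ↦ congrFun D.mulVec_a k
    simp only [latticeMap, LinearMap.coe_mk, AddHom.coe_mk, Matrix.vecMul, dotProduct,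
      Int.cast_sum, Int.cast_mul, Finset.sum_mul, Finset.mul_sum]
    rw [Finset.sum_comm]
    refine Finset.sum_congr rfl fun k _ ↦ ?_
    simp only [mul_assoc]
    rw [← Finset.mul_sum, h]
    ring
  · simp only [latticeMap, LinearMap.coe_mk, AddHom.coe_mk, Matrix.vecMul, dotProduct,
      Int.cast_sum, Int.cast_mul, Complex.ofReal_sum, Complex.ofReal_mul, Complex.ofReal_intCast,
      Finset.sum_smul]
    rw [Finset.sum_comm, Matrix.mulVec_sum]
    refine Finset.sum_congr rfl fun k _ ↦ ?_
    rw [Matrix.mulVec_smul, mul_b, Finset.smul_sum]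
    exact Finset.sum_congr rfl fun i _ ↦ by rw [mul_smul]

theorem g₀_mul_trans (c : Fin (2 * n + 1) → ℤ) :
    D.g₀ * D.trans c = D.trans (c ᵥ* D.M.1) * D.g₀ := by
  ext1 p
  rw [Equiv.Perm.mul_apply, Equiv.Perm.mul_apply, trans_apply, trans_apply, latticeMap_vecMul]
  refine Prod.ext (UpperHalfPlane.ext ?_) ?_
  · simp [g₀]
  · simp [g₀, Matrix.mulVec_add]

theorem g₀_inv_mul_trans (c : Fin (2 * n + 1) → ℤ) :
    D.g₀⁻¹ * D.trans c = D.trans (c ᵥ* (D.M⁻¹).1) * D.g₀⁻¹ := by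
  rw [inv_mul_eq_iff_eq_mul, ← mul_assoc, g₀_mul_trans, Matrix.vecMul_vecMul]
  have : (D.M⁻¹).1 * D.M.1 = 1 := by
    rw [← Matrix.SpecialLinearGroup.coe_mul, inv_mul_cancel, Matrix.SpecialLinearGroup.coe_one]
  rw [this, Matrix.vecMul_one, mul_assoc, mul_inv_cancel, mul_one]

theorem g₀_zpow_mul_trans (m : ℤ) : ∀ c : Fin (2 * n + 1) → ℤ,
    ∃ c', D.g₀ ^ m * D.trans c = D.trans c' * D.g₀ ^ m := by
  induction m with
  | zero => exact fun c ↦ ⟨c, by simp⟩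
  | succ m ih =>
    intro c
    obtain ⟨c', hc'⟩ := ih (c ᵥ* D.M.1)
    exact ⟨c', by rw [zpow_add_one, mul_assoc, g₀_mul_trans, ← mul_assoc, hc', mul_assoc]⟩
  | pred m ih =>
    intro c
    obtain ⟨c', hc'⟩ := ih (c ᵥ* (D.M⁻¹).1)
    exact ⟨c', by rw [zpow_sub_one, mul_assoc, g₀_inv_mul_trans, ← mul_assoc, hc', mul_assoc]⟩

theorem exists_eq_of_mem {γ : Equiv.Perm (ℍ × (Fin n → ℂ))} (hγ : γ ∈ D.GM) :
    ∃ (c : Fin (2 * n + 1) → ℤ) (m : ℤ), γ = D.trans c * D.g₀ ^ m := by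
  induction hγ using Subgroup.closure_induction with
  | mem x hx =>
    rcases hx with rfl | ⟨i, rfl⟩
    · exact ⟨0, 1, by rw [trans_zero, zpow_one, one_mul]⟩
    · exact ⟨Pi.single i 1, 0, by rw [g_eq_trans, zpow_zero, mul_one]⟩
  | one => exact ⟨0, 0, by rw [trans_zero, zpow_zero, one_mul]⟩
  | mul x y _ _ hx hy =>
    obtain ⟨c, m, rfl⟩ := hx
    obtain ⟨c', m', rfl⟩ := hy
    obtain ⟨d, hd⟩ := D.g₀_zpow_mul_trans m c'
    refine ⟨c + d, m + m', ?_⟩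
    rw [trans_add, zpow_add, mul_assoc, ← mul_assoc (D.g₀ ^ m), hd]
    simp only [mul_assoc]
  | inv x _ hx =>
    obtain ⟨c, m, rfl⟩ := hx
    obtain ⟨d, hd⟩ := D.g₀_zpow_mul_trans (-m) (-c)
    refine ⟨d, -m, ?_⟩
    rw [mul_inv_rev, ← zpow_neg, ← trans_neg, hd]

theorem im_g₀_zpow (m : ℤ) : ∀ p : ℍ × (Fin n → ℂ),
    ((D.g₀ ^ m) p).1.im = D.α ^ m * p.1.im := by
  have h0 : ∀ p, (D.g₀ p).1.im = D.α * p.1.im := fun p ↦ by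
    simp [g₀, UpperHalfPlane.pos_real_im]
  have h1 : ∀ p, (D.g₀⁻¹ p).1.im = D.α⁻¹ * p.1.im := fun p ↦ by
    have := h0 (D.g₀⁻¹ p)
    rw [← Equiv.Perm.mul_apply, mul_inv_cancel, Equiv.Perm.one_apply] at this
    rw [this, inv_mul_cancel_left₀ D.α_pos.ne']
  induction m with
  | zero => intro p; simp
  | succ m ih =>
    intro p
    rw [zpow_add_one, Equiv.Perm.mul_apply, ih, h0, zpow_add_one₀ D.α_pos.ne', mul_assoc]
  | pred m ih =>
    intro p
    rw [zpow_sub_one, Equiv.Perm.mul_apply, ih, h1, zpow_sub_one₀ D.α_pos.ne', mul_assoc]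

theorem im_trans (c : Fin (2 * n + 1) → ℤ) (p : ℍ × (Fin n → ℂ)) :
    (D.trans c p).1.im = p.1.im := by
  rw [trans_apply]; simp

theorem contMDiff_affine (s t : ℝ) (A : Matrix (Fin n) (Fin n) ℂ) (v : Fin n → ℂ)
    (f : ℍ × (Fin n → ℂ) → ℍ × (Fin n → ℂ)) (h1 : ∀ p, ((f p).1 : ℂ) = s * (p.1 : ℂ) + t)
    (h2 : ∀ p, (f p).2 = A *ᵥ p.2 + v) :
    ContMDiff (𝓘(ℂ, ℂ).prod 𝓘(ℂ, Fin n → ℂ)) (𝓘(ℂ, ℂ).prod 𝓘(ℂ, Fin n → ℂ)) ω f := by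
  have hA : ContDiff ℂ ω (fun z : Fin n → ℂ ↦ A *ᵥ z + v) :=
    (LinearMap.toContinuousLinearMap (Matrix.mulVecLin A)).contDiff.add contDiff_const
  have hf2 : ContMDiff (𝓘(ℂ, ℂ).prod 𝓘(ℂ, Fin n → ℂ)) 𝓘(ℂ, Fin n → ℂ) ω
      (fun p : ℍ × (Fin n → ℂ) ↦ (f p).2) := by
    have : (fun p : ℍ × (Fin n → ℂ) ↦ (f p).2) = (fun z ↦ A *ᵥ z + v) ∘ Prod.snd := funext h2
    rw [this]
    exact hA.contMDiff.comp contMDiff_snd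
  have hcoe : ContMDiff (𝓘(ℂ, ℂ).prod 𝓘(ℂ, Fin n → ℂ)) 𝓘(ℂ, ℂ) ω
      (fun p : ℍ × (Fin n → ℂ) ↦ ((f p).1 : ℂ)) := by
    have : (fun p : ℍ × (Fin n → ℂ) ↦ ((f p).1 : ℂ)) =
        (fun w : ℂ ↦ (s : ℂ) * w + t) ∘ ((↑) : ℍ → ℂ) ∘ Prod.fst := funext h1
    rw [this]
    have hd : ContDiff ℂ ω (fun w : ℂ ↦ (s : ℂ) * w + t) := by fun_prop
    exact hd.contMDiff.comp (UpperHalfPlane.contMDiff_coe.comp contMDiff_fst)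
  have hf1 : ContMDiff (𝓘(ℂ, ℂ).prod 𝓘(ℂ, Fin n → ℂ)) 𝓘(ℂ, ℂ) ω
      (fun p : ℍ × (Fin n → ℂ) ↦ (f p).1) := by
    intro p
    refine contMDiffAt_iff_target.2 ⟨?_, hcoe p⟩
    rw [UpperHalfPlane.isEmbedding_coe.continuousAt_iff]
    exact (hcoe p).continuousAt
  exact hf1.prodMk hf2

theorem contMDiff_g₀ :
    ContMDiff (𝓘(ℂ, ℂ).prod 𝓘(ℂ, Fin n → ℂ)) (𝓘(ℂ, ℂ).prod 𝓘(ℂ, Fin n → ℂ)) ω D.g₀ :=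
  contMDiff_affine D.α 0 D.Rᵀ 0 _ (fun p ↦ by simp [g₀]) (fun p ↦ by simp [g₀])

theorem contMDiff_g₀_inv :
    ContMDiff (𝓘(ℂ, ℂ).prod 𝓘(ℂ, Fin n → ℂ)) (𝓘(ℂ, ℂ).prod 𝓘(ℂ, Fin n → ℂ)) ω
      (D.g₀⁻¹ : Equiv.Perm _) :=
  contMDiff_affine D.α⁻¹ 0 D.Rᵀ⁻¹ 0 _ (fun p ↦ by simp [g₀, Equiv.Perm.inv_def])
    (fun p ↦ by simp [g₀, Equiv.Perm.inv_def])

theorem contMDiff_g₀_zpow (m : ℤ) :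
    ContMDiff (𝓘(ℂ, ℂ).prod 𝓘(ℂ, Fin n → ℂ)) (𝓘(ℂ, ℂ).prod 𝓘(ℂ, Fin n → ℂ)) ω
      (D.g₀ ^ m : Equiv.Perm _) := by
  induction m with
  | zero => exact contMDiff_id
  | succ m ih =>
    rw [zpow_add_one]
    exact ih.comp D.contMDiff_g₀
  | pred m ih =>
    rw [zpow_sub_one]
    exact ih.comp D.contMDiff_g₀_inv

theorem contMDiff_of_mem {γ : Equiv.Perm (ℍ × (Fin n → ℂ))} (hγ : γ ∈ D.GM) :
    ContMDiff (𝓘(ℂ, ℂ).prod 𝓘(ℂ, Fin n → ℂ)) (𝓘(ℂ, ℂ).prod 𝓘(ℂ, Fin n → ℂ)) ω γ := by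
  obtain ⟨c, m, rfl⟩ := D.exists_eq_of_mem hγ
  have h : ContMDiff (𝓘(ℂ, ℂ).prod 𝓘(ℂ, Fin n → ℂ)) (𝓘(ℂ, ℂ).prod 𝓘(ℂ, Fin n → ℂ)) ω
      (D.trans c) :=
    contMDiff_affine 1 (D.latticeMap (fun i ↦ (c i : ℝ))).1 1
      (D.latticeMap (fun i ↦ (c i : ℝ))).2 _
      (fun p ↦ by simp [trans_apply, add_comm]) (fun p ↦ by simp [trans_apply])
  exact h.comp (D.contMDiff_g₀_zpow m)

instance : ContinuousConstSMul D.GM (ℍ × (Fin n → ℂ)) where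
  continuous_const_smul γ := (D.contMDiff_of_mem γ.2).continuous

instance : IsCancelSMul D.GM (ℍ × (Fin n → ℂ)) := by
  rw [isCancelSMul_iff_eq_one_of_smul_eq]
  rintro ⟨γ, hγ⟩ p hp
  obtain ⟨c, m, rfl⟩ := D.exists_eq_of_mem hγ
  have hp' : D.trans c ((D.g₀ ^ m) p) = p := hp
  have him := congrArg (fun q : ℍ × (Fin n → ℂ) ↦ q.1.im) hp'
  simp only [im_trans, im_g₀_zpow] at him
  have h1 : D.α ^ m = 1 := by
    have := p.1.im_pos
    field_simp at him
    exact him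
  have hm : m = 0 := (zpow_eq_one_iff_right₀ D.α_pos.le D.α_ne_one).1 h1
  subst hm
  rw [zpow_zero, Equiv.Perm.one_apply, trans_apply] at hp'
  have hc : D.latticeMap (fun i ↦ (c i : ℝ)) = D.latticeMap 0 := by
    rw [map_zero]
    refine Prod.ext ?_ ?_
    · have := congrArg (fun q : ℍ × (Fin n → ℂ) ↦ (q.1 : ℂ)) hp'
      simpa using this
    · have := congrArg Prod.snd hp'
      simpa using this
  have hc0 : c = 0 := by
    ext i
    have := congrFun (D.latticeMap_injective hc) i
    simpa using this
  apply Subtype.ext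
  change D.trans c * D.g₀ ^ (0 : ℤ) = 1
  rw [hc0, trans_zero, zpow_zero, mul_one]

theorem finite_zpow_mem_Icc {α : ℝ} (h0 : 0 < α) (h1 : α ≠ 1) {s t : ℝ} (hs : 0 < s) :
    {m : ℤ | α ^ m ∈ Set.Icc s t}.Finite := by
  have hlog : Real.log α ≠ 0 := Real.log_ne_zero_of_pos_of_ne_one h0 h1
  have hmem : ∀ m : ℤ, α ^ m ∈ Set.Icc s t → |(m : ℝ)| ≤
      (|Real.log s| + |Real.log t|) / |Real.log α| := by
    intro m hm
    rw [le_div_iff₀ (abs_pos.2 hlog), ← abs_mul, ← Real.log_zpow]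
    have hp : 0 < α ^ m := zpow_pos h0 m
    have h2 := Real.log_le_log hs hm.1
    have h3 := Real.log_le_log hp hm.2
    rw [abs_le]
    constructor
    · linarith [neg_abs_le (Real.log s), abs_nonneg (Real.log t)]
    · linarith [le_abs_self (Real.log t), abs_nonneg (Real.log s)]
  refine (Set.finite_Icc (-⌈(|Real.log s| + |Real.log t|) / |Real.log α|⌉)
    ⌈(|Real.log s| + |Real.log t|) / |Real.log α|⌉).subset fun m hm ↦ ?_
  have h := (hmem m hm).trans (Int.le_ceil _)
  rw [abs_le] at h
  exact ⟨by exact_mod_cast h.1, by exact_mod_cast h.2⟩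

theorem finite_latticeMap_mem {S : Set (ℝ × (Fin n → ℂ))} (hS : IsCompact S) :
    {c : Fin (2 * n + 1) → ℤ | D.latticeMap (fun i ↦ (c i : ℝ)) ∈ S}.Finite := by
  have hemb : Topology.IsClosedEmbedding D.latticeMap :=
    LinearMap.isClosedEmbedding_of_injective (LinearMap.ker_eq_bot.2 D.latticeMap_injective)
  obtain ⟨r, hr⟩ := (hemb.isCompact_preimage hS).isBounded.exists_norm_le
  refine (Set.Finite.pi' (t := fun _ : Fin (2 * n + 1) ↦ Set.Icc (-⌈r⌉) ⌈r⌉)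
    fun _ ↦ Set.finite_Icc _ _).subset fun c hc i ↦ ?_
  have h1 := (norm_le_pi_norm (fun i ↦ (c i : ℝ)) i).trans (hr _ hc)
  have h := h1.trans (Int.le_ceil r)
  rw [Real.norm_eq_abs, abs_le] at h
  exact ⟨by exact_mod_cast h.1, by exact_mod_cast h.2⟩

theorem finite_trans {K L : Set (ℍ × (Fin n → ℂ))} (hK : IsCompact K) (hL : IsCompact L) :
    {c : Fin (2 * n + 1) → ℤ | (D.trans c '' K ∩ L).Nonempty}.Finite := by
  let S : Set (ℝ × (Fin n → ℂ)) := (fun pq : (ℍ × (Fin n → ℂ)) × (ℍ × (Fin n → ℂ)) ↦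
    (pq.2.1.re - pq.1.1.re, pq.2.2 - pq.1.2)) '' (K ×ˢ L)
  have hS : IsCompact S := by
    refine (hK.prod hL).image ?_
    have := UpperHalfPlane.continuous_re
    fun_prop
  refine (D.finite_latticeMap_mem hS).subset ?_
  rintro c ⟨_, ⟨p, hp, rfl⟩, hq⟩
  refine ⟨(p, D.trans c p), ⟨hp, hq⟩, ?_⟩
  rw [trans_apply]
  simp

instance : ProperlyDiscontinuousSMul D.GM (ℍ × (Fin n → ℂ)) where
  finite_disjoint_inter_image := by
    intro K L hK hL
    rcases K.eq_empty_or_nonempty with rfl | hK0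
    · simp
    rcases L.eq_empty_or_nonempty with rfl | hL0
    · simp
    have hcont : Continuous (fun p : ℍ × (Fin n → ℂ) ↦ p.1.im) :=
      UpperHalfPlane.continuous_im.comp continuous_fst
    obtain ⟨k₁, hk₁, hk₁'⟩ := hK.exists_isMinOn hK0 hcont.continuousOn
    obtain ⟨k₂, hk₂, hk₂'⟩ := hK.exists_isMaxOn hK0 hcont.continuousOn
    obtain ⟨l₁, hl₁, hl₁'⟩ := hL.exists_isMinOn hL0 hcont.continuousOn
    obtain ⟨l₂, hl₂, hl₂'⟩ := hL.exists_isMaxOn hL0 hcont.continuousOn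
    have hF := finite_zpow_mem_Icc D.α_pos D.α_ne_one (s := l₁.1.im / k₂.1.im)
      (t := l₂.1.im / k₁.1.im) (div_pos l₁.1.im_pos k₂.1.im_pos)
    refine Set.Finite.of_finite_image (f := Subtype.val) ?_ Subtype.val_injective.injOn
    refine (hF.biUnion fun m _ ↦ (D.finite_trans
      (hK.image (D.contMDiff_g₀_zpow m).continuous) hL).image
        (fun c ↦ D.trans c * D.g₀ ^ m)).subset ?_
    rintro _ ⟨⟨γ, hγ⟩, ⟨_, ⟨p, hp, rfl⟩, hq⟩, rfl⟩
    obtain ⟨c, m, rfl⟩ := D.exists_eq_of_mem hγ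
    have hq' : D.trans c ((D.g₀ ^ m) p) ∈ L := hq
    have him : (D.trans c ((D.g₀ ^ m) p)).1.im = D.α ^ m * p.1.im := by
      rw [im_trans, im_g₀_zpow]
    have e1 : l₁.1.im ≤ D.α ^ m * p.1.im := him ▸ hl₁' hq'
    have e2 : D.α ^ m * p.1.im ≤ l₂.1.im := him ▸ hl₂' hq'
    have e3 : k₁.1.im ≤ p.1.im := hk₁' hp
    have e4 : p.1.im ≤ k₂.1.im := hk₂' hp
    have hpos : 0 < D.α ^ m := zpow_pos D.α_pos m
    refine Set.mem_biUnion (x := m) ⟨?_, ?_⟩ ⟨c, ⟨_, ⟨_, ⟨p, hp, rfl⟩, rfl⟩, hq'⟩, rfl⟩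
    · rw [div_le_iff₀ k₂.1.im_pos]
      exact e1.trans (mul_le_mul_of_nonneg_left e4 hpos.le)
    · rw [le_div_iff₀ k₁.1.im_pos]
      exact (mul_le_mul_of_nonneg_left e3 hpos.le).trans e2

/-- The model of `ℍ × ℂⁿ` and of `T_M` on the vector space `ℂ × ℂⁿ`. -/
abbrev model (n : ℕ) : ModelWithCorners ℂ (ℂ × (Fin n → ℂ)) (ModelProd ℂ (Fin n → ℂ)) :=
  𝓘(ℂ, ℂ).prod 𝓘(ℂ, Fin n → ℂ)

/-- The quotient `T_M = (ℍ × ℂⁿ) / G_M`. -/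
abbrev TM : Type := MulAction.orbitRel.Quotient D.GM (ℍ × (Fin n → ℂ))

theorem contMDiff_smul (γ : D.GM) :
    ContMDiff (model n) (model n) ω (fun p : ℍ × (Fin n → ℂ) ↦ γ • p) :=
  D.contMDiff_of_mem γ.2

/-- `T_M` is a complex manifold. -/
instance : IsManifold (model n) ω D.TM := isManifold_orbitRel_quotient (model n) ω D.contMDiff_smul

instance : IsManifold (model n) 1 D.TM := IsManifold.of_le (n := ω) le_top

end InoueData

end

noncomputable section

namespace InoueData

variable {n : ℕ} (D : InoueData n)

/-! Write `u_i` for the translation vector of `g_i`. The `2n+1` vectors `u_i` form a real basis of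
`ℝ × ℂⁿ`, and in this basis the real linear map `(t, u) ↦ (α t, Rᵀ u)` has matrix `Mᵀ`. Two facts
follow. Comparing real determinants gives `α |det R|² = 1` (`alpha_mul_normSq_det_R`). And `1` is
not an eigenvalue of `(w, z) ↦ (α w, Rᵀ z)`, because `α ≠ 1` and a fixed vector of `Rᵀ` would make
`1` a real eigenvalue of `M` other than `α`.

The analytic core is `exists_eq_const_of_invariant`: a holomorphic function on `ℍ × ℂⁿ` invariant
under the lattice translations is constant. On a set with `Im w` fixed it is continuous and periodic
for a full lattice, hence bounded, so Liouville's theorem on each fibre `{w} × ℂⁿ` removes the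
dependence on `z`. The remaining function of `w` is invariant under the group generated by the
`a^{(i)}`. This group is stable under multiplication by `α` and `α⁻¹`, hence dense in `ℝ`.
Invariance under all real translations forces the derivative to vanish.

A 1-form or a section of `K^{⊗ k}` pulls back to `ℍ × ℂⁿ` with translation-invariant coefficients in
the constant frame, so these are constants. Invariance under `g₀` then says that a constant covector
is fixed by precomposition with `(w, z) ↦ (α w, Rᵀ z)`, which forces it to be zero, or that a
constant `C` satisfies `C (α det R)^k = C`. Since `|α det R|² = α ≠ 1`, this gives `C = 0`. -/

/-! ### Linear algebra of `M` and of the linear part of `g₀` -/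

theorem latticeMap_surjective : Function.Surjective D.latticeMap := by
  refine (LinearMap.injective_iff_surjective_of_finrank_eq_finrank ?_).1 D.latticeMap_injective
  rw [Module.finrank_prod, Module.finrank_self, Module.finrank_pi, Module.finrank_pi_fintype]
  simp only [Complex.finrank_real_complex, Finset.sum_const, Finset.card_univ, Fintype.card_fin,
    smul_eq_mul]
  omega

/-- `M` as a real matrix. -/
def MR : Matrix (Fin (2 * n + 1)) (Fin (2 * n + 1)) ℝ := D.M.1.map (Int.cast : ℤ → ℝ)

/-- The real linear map `(t, u) ↦ (α t, Rᵀ u)`. -/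
def scaleReal : ℝ × (Fin n → ℂ) →ₗ[ℝ] ℝ × (Fin n → ℂ) :=
  (D.α • LinearMap.id).prodMap ((Matrix.toLin' D.Rᵀ).restrictScalars ℝ)

/-- The standard basis vectors are integral, so the relation `latticeMap_vecMul` for integer vectors
already determines the real linear identity. -/
theorem latticeMap_comp_toLin' :
    D.latticeMap ∘ₗ Matrix.toLin' D.MRᵀ = D.scaleReal ∘ₗ D.latticeMap := by
  refine (Pi.basisFun ℝ (Fin (2 * n + 1))).ext fun i ↦ ?_
  have h := D.latticeMap_vecMul (Pi.single i 1)
  have h1 : (fun j ↦ ((Pi.single i 1 : Fin (2 * n + 1) → ℤ) j : ℝ)) = Pi.single i 1 := by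
    ext j
    by_cases hj : j = i
    · subst hj; simp
    · simp [hj]
  have h2 : (fun j ↦ (((Pi.single i 1 : Fin (2 * n + 1) → ℤ) ᵥ* D.M.1) j : ℝ))
      = D.MRᵀ *ᵥ Pi.single i 1 := by
    ext j
    simp [MR]
  rw [h1, h2] at h
  rw [LinearMap.comp_apply, LinearMap.comp_apply, Pi.basisFun_apply, Matrix.toLin'_apply, h]
  rfl

theorem det_MR : D.MR.det = 1 := by
  have := (Int.castRingHom ℝ).map_det D.M.1
  rw [D.M.2, map_one] at this
  exact this.symm

/-- `scaleReal` is conjugate to `Mᵀ`, of determinant `1`; its own real determinant is `α` times that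
of `Rᵀ`, and the real determinant of a complex linear map is the squared modulus of the complex one.
-/
theorem alpha_mul_normSq_det_R : D.α * Complex.normSq D.R.det = 1 := by
  let e := LinearEquiv.ofBijective D.latticeMap ⟨D.latticeMap_injective, D.latticeMap_surjective⟩
  have h : D.scaleReal = (e : _ →ₗ[ℝ] _) ∘ₗ Matrix.toLin' D.MRᵀ ∘ₗ (e.symm : _ →ₗ[ℝ] _) := by
    rw [← LinearMap.comp_assoc]
    change _ = (D.latticeMap ∘ₗ Matrix.toLin' D.MRᵀ) ∘ₗ _
    rw [D.latticeMap_comp_toLin', LinearMap.comp_assoc]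
    refine LinearMap.ext fun x ↦ ?_
    change _ = D.scaleReal (e (e.symm x))
    rw [e.apply_symm_apply]
  have h1 : LinearMap.det D.scaleReal = 1 := by
    rw [h, LinearMap.det_conj, LinearMap.det_toLin', Matrix.det_transpose, D.det_MR]
  rw [scaleReal, LinearMap.det_prodMap, LinearMap.det_smul, LinearMap.det_id,
    Module.finrank_self, LinearMap.det_restrictScalars, LinearMap.det_toLin',
    Matrix.det_transpose, Algebra.norm_complex_apply] at h1
  simpa using h1

/-- The squared modulus of `α det R` is `α · (α |det R|²) = α`, and a positive real other than `1`
has no positive power equal to `1`. -/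
theorem alpha_mul_det_R_pow_ne_one {k : ℕ} (hk : 0 < k) :
    ((D.α : ℂ) * D.R.det) ^ k ≠ 1 := by
  intro h
  have h1 := congrArg Complex.normSq h
  rw [map_pow, map_mul, map_one, Complex.normSq_ofReal, mul_assoc, D.alpha_mul_normSq_det_R,
    mul_one] at h1
  exact D.α_ne_one ((pow_eq_one_iff_of_nonneg D.α_pos.le hk.ne').1 h1)

/-- The complex linear map `(w, z) ↦ (α w, Rᵀ z)`. -/
def scale : ℂ × (Fin n → ℂ) →L[ℂ] ℂ × (Fin n → ℂ) :=
  LinearMap.toContinuousLinearMap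
    (((D.α : ℂ) • LinearMap.id).prodMap (Matrix.toLin' D.Rᵀ))

theorem scale_apply (q : ℂ × (Fin n → ℂ)) : D.scale q = (D.α * q.1, D.Rᵀ *ᵥ q.2) := rfl

theorem det_scale : LinearMap.det (D.scale : ℂ × (Fin n → ℂ) →ₗ[ℂ] ℂ × (Fin n → ℂ))
    = D.α * D.R.det := by
  rw [scale, LinearMap.coe_toContinuousLinearMap, LinearMap.det_prodMap, LinearMap.det_smul,
    LinearMap.det_id, Module.finrank_self, LinearMap.det_toLin', Matrix.det_transpose]
  simp

/-- Lifting `(0, u)` through the isomorphism `latticeMap` gives a vector fixed by `Mᵀ`, while `1` is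
not an eigenvalue of `M`. -/
theorem eq_zero_of_mulVec_R_eq {u : Fin n → ℂ} (hu : D.Rᵀ *ᵥ u = u) : u = 0 := by
  obtain ⟨c, hc⟩ := D.latticeMap_surjective (0, u)
  have h := LinearMap.congr_fun D.latticeMap_comp_toLin' c
  have hfix : D.MRᵀ *ᵥ c = c := by
    apply D.latticeMap_injective
    rw [LinearMap.comp_apply, LinearMap.comp_apply, hc] at h
    rw [hc]
    refine h.trans (Prod.ext ?_ hu)
    simp [scaleReal]
  -- Otherwise `1` would be a root of the characteristic polynomial that is real and different from
  -- `α`.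
  have hdet : (1 - D.MR).det ≠ 0 := by
    intro h0
    have h1 : (1 - D.MC).det = 0 := by
      have h2 := (Complex.ofRealHom).map_det (1 - D.MR)
      rw [h0, map_zero] at h2
      rw [h2]
      congr 1
      ext i j
      by_cases hij : i = j <;> simp [MR, hij]
    have h3 : D.MC.charpoly.IsRoot 1 := by
      rw [Polynomial.IsRoot, Matrix.eval_charpoly, map_one, h1]
    exact D.im_ne_zero 1 h3 (fun h ↦ D.α_ne_one (by exact_mod_cast h.symm)) (by simp)
  have hc0 : c = 0 := by
    by_contra hne
    refine hdet (Matrix.exists_vecMul_eq_zero_iff.1 ⟨c, hne, ?_⟩)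
    rw [Matrix.vecMul_sub, Matrix.vecMul_one, ← Matrix.mulVec_transpose, hfix, sub_self]
  rw [hc0, map_zero] at hc
  exact (congrArg Prod.snd hc).symm

/-- The form `l` vanishes on the image of `scale - id`, which is injective and therefore surjective
in finite dimension. -/
theorem eq_zero_of_comp_scale_eq {l : ℂ × (Fin n → ℂ) →L[ℂ] ℂ} (hl : l ∘L D.scale = l) :
    l = 0 := by
  let S : ℂ × (Fin n → ℂ) →ₗ[ℂ] ℂ × (Fin n → ℂ) := (D.scale : _ →ₗ[ℂ] _) - LinearMap.id
  have hinj : Function.Injective S := by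
    rw [← LinearMap.ker_eq_bot, LinearMap.ker_eq_bot']
    intro q hq
    have hq' : D.scale q = q := sub_eq_zero.1 hq
    rw [scale_apply] at hq'
    refine Prod.ext ?_ (D.eq_zero_of_mulVec_R_eq (congrArg Prod.snd hq'))
    have h1 : (D.α : ℂ) * q.1 = q.1 := congrArg Prod.fst hq'
    by_contra hne
    have h2 : (D.α : ℂ) = 1 := by
      apply mul_right_cancel₀ (show q.1 ≠ 0 from hne)
      rw [h1, one_mul]
    exact D.α_ne_one (by exact_mod_cast h2)
  refine ContinuousLinearMap.ext fun q ↦ ?_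
  obtain ⟨q', rfl⟩ := LinearMap.injective_iff_surjective.1 hinj q
  change l (D.scale q' - q') = 0
  rw [map_sub, sub_eq_zero]
  exact DFunLike.congr_fun hl q'

/-! ### Density of the group generated by the coordinates of `a` -/

/-- The subgroup of `ℝ` generated by the coordinates of the eigenvector `a`. -/
def coordSubgroup : AddSubgroup ℝ :=
  AddMonoidHom.range
    (AddMonoidHom.mk' (fun c : Fin (2 * n + 1) → ℤ ↦ (D.latticeMap (fun i ↦ (c i : ℝ))).1)
      fun c d ↦ by
        rw [← Prod.fst_add, ← map_add]
        congr 2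
        ext i
        simp)

theorem alpha_mul_mem_coordSubgroup {t : ℝ} (ht : t ∈ D.coordSubgroup) :
    D.α * t ∈ D.coordSubgroup := by
  obtain ⟨c, rfl⟩ := ht
  exact ⟨c ᵥ* D.M.1, congrArg Prod.fst (D.latticeMap_vecMul c)⟩

/-- The inverse of `M` is again integral, so it too acts on integer coefficient vectors. -/
theorem alpha_inv_mul_mem_coordSubgroup {t : ℝ} (ht : t ∈ D.coordSubgroup) :
    D.α⁻¹ * t ∈ D.coordSubgroup := by
  obtain ⟨c, rfl⟩ := ht
  refine ⟨c ᵥ* (D.M⁻¹).1, ?_⟩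
  have h := congrArg Prod.fst (D.latticeMap_vecMul (c ᵥ* (D.M⁻¹).1))
  rw [Matrix.vecMul_vecMul, ← Matrix.SpecialLinearGroup.coe_mul, inv_mul_cancel,
    Matrix.SpecialLinearGroup.coe_one, Matrix.vecMul_one] at h
  simp only [AddMonoidHom.mk'_apply]
  rw [h, inv_mul_cancel_left₀ D.α_pos.ne']

theorem exists_pos_mem_coordSubgroup : ∃ t ∈ D.coordSubgroup, 0 < t := by
  obtain ⟨i, hi⟩ : ∃ i, D.a i ≠ 0 := by
    by_contra! h
    exact D.a_ne_zero (funext h)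
  have hmem : D.a i ∈ D.coordSubgroup := by
    refine ⟨Pi.single i 1, ?_⟩
    simp [latticeMap, Pi.single_apply]
  rcases lt_or_gt_of_ne hi with h | h
  · exact ⟨-D.a i, neg_mem hmem, by linarith⟩
  · exact ⟨D.a i, hmem, h⟩

/-- One of `α`, `α⁻¹` is a factor `r < 1` preserving the subgroup, so `r ^ m * t` provides
arbitrarily small positive elements. -/
theorem dense_coordSubgroup : Dense (D.coordSubgroup : Set ℝ) := by
  obtain ⟨t, ht, hpos⟩ := D.exists_pos_mem_coordSubgroup
  obtain ⟨r, hr0, hr1, hr⟩ : ∃ r : ℝ, 0 < r ∧ r < 1 ∧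
      ∀ s ∈ D.coordSubgroup, r * s ∈ D.coordSubgroup := by
    rcases lt_or_gt_of_ne D.α_ne_one with h | h
    · exact ⟨D.α, D.α_pos, h, fun s ↦ D.alpha_mul_mem_coordSubgroup⟩
    · exact ⟨D.α⁻¹, inv_pos.2 D.α_pos, inv_lt_one_of_one_lt₀ h,
        fun s ↦ D.alpha_inv_mul_mem_coordSubgroup⟩
  have hpow : ∀ m : ℕ, r ^ m * t ∈ D.coordSubgroup := by
    intro m
    induction m with
    | zero => simpa using ht
    | succ m ih => rw [pow_succ', mul_assoc]; exact hr _ ih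
  refine AddSubgroup.dense_of_not_isolated_zero _ fun ε hε ↦ ?_
  obtain ⟨m, hm⟩ := exists_pow_lt_of_lt_one (div_pos hε hpos) hr1
  exact ⟨r ^ m * t, hpow m, by positivity, (lt_div_iff₀ hpos).1 hm⟩

/-! ### Translation-invariant holomorphic functions are constant -/

/-- The vector `∑ i, c i • u_i` of `ℂ × ℂⁿ`. -/
def latticeVec (c : Fin (2 * n + 1) → ℝ) : ℂ × (Fin n → ℂ) :=
  (((D.latticeMap c).1 : ℂ), (D.latticeMap c).2)

/-- The open subset `ℍ × ℂⁿ` of `ℂ × ℂⁿ`. -/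
def upperDomain (n : ℕ) : Set (ℂ × (Fin n → ℂ)) := {q | 0 < q.1.im}

theorem isOpen_upperDomain (n : ℕ) : IsOpen (upperDomain n) :=
  isOpen_lt continuous_const (Complex.continuous_im.comp continuous_fst)

theorem add_latticeVec_mem {q : ℂ × (Fin n → ℂ)} (hq : q ∈ upperDomain n)
    (c : Fin (2 * n + 1) → ℝ) : q + D.latticeVec c ∈ upperDomain n := by
  simpa [upperDomain, latticeVec] using hq

theorem scale_mem {q : ℂ × (Fin n → ℂ)} (hq : q ∈ upperDomain n) :
    D.scale q ∈ upperDomain n := by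
  have h : 0 < q.1.im := hq
  simpa [upperDomain, scale_apply] using mul_pos D.α_pos h

theorem continuous_latticeVec : Continuous D.latticeVec := by
  have h : Continuous D.latticeMap := LinearMap.continuous_of_finiteDimensional _
  unfold latticeVec
  fun_prop

theorem latticeVec_add (c d : Fin (2 * n + 1) → ℝ) :
    D.latticeVec (c + d) = D.latticeVec c + D.latticeVec d := by
  simp [latticeVec]

/-- Splitting each coefficient into integer and fractional part reduces the bound to the compact
unit cube. -/
theorem exists_bound_add_latticeVec {F : ℂ × (Fin n → ℂ) → ℂ}
    (hF : DifferentiableOn ℂ F (upperDomain n))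
    (hinv : ∀ q ∈ upperDomain n, ∀ c : Fin (2 * n + 1) → ℤ,
      F (q + D.latticeVec (fun i ↦ (c i : ℝ))) = F q)
    {q : ℂ × (Fin n → ℂ)} (hq : q ∈ upperDomain n) :
    ∃ C, ∀ c : Fin (2 * n + 1) → ℝ, ‖F (q + D.latticeVec c)‖ ≤ C := by
  have hcont : Continuous fun c : Fin (2 * n + 1) → ℝ ↦ F (q + D.latticeVec c) := by
    refine hF.continuousOn.comp_continuous ?_ fun c ↦ D.add_latticeVec_mem hq c
    exact continuous_const.add D.continuous_latticeVec
  obtain ⟨C, hC⟩ := (isCompact_univ_pi fun _ : Fin (2 * n + 1) ↦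
    isCompact_Icc (a := (0 : ℝ)) (b := 1)).exists_bound_of_continuousOn hcont.continuousOn
  refine ⟨C, fun c ↦ ?_⟩
  have h := hinv _ (D.add_latticeVec_mem hq fun i ↦ Int.fract (c i)) fun i ↦ ⌊c i⌋
  rw [add_assoc, ← latticeVec_add] at h
  have hc : (fun i ↦ Int.fract (c i)) + (fun i ↦ (⌊c i⌋ : ℝ)) = c := by
    ext i
    simp
  rw [hc] at h
  rw [h]
  exact hC _ fun i _ ↦ ⟨Int.fract_nonneg _, (Int.fract_lt_one _).le⟩

/-- Liouville's theorem on the fibres `ℂⁿ`. -/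
theorem eq_of_fst_eq {F : ℂ × (Fin n → ℂ) → ℂ}
    (hF : DifferentiableOn ℂ F (upperDomain n))
    (hinv : ∀ q ∈ upperDomain n, ∀ c : Fin (2 * n + 1) → ℤ,
      F (q + D.latticeVec (fun i ↦ (c i : ℝ))) = F q)
    {w : ℂ} (hw : 0 < w.im) (z z' : Fin n → ℂ) : F (w, z) = F (w, z') := by
  have hd : Differentiable ℂ fun z : Fin n → ℂ ↦ F (w, z) := fun z ↦
    (hF.differentiableAt ((isOpen_upperDomain n).mem_nhds
      (show (w, z) ∈ upperDomain n from hw))).comp z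
      ((differentiableAt_const w).prodMk differentiableAt_id)
  refine hd.apply_eq_apply_of_bounded ?_ z z'
  obtain ⟨C, hC⟩ := D.exists_bound_add_latticeVec hF hinv (q := (w, 0)) hw
  refine isBounded_iff_forall_norm_le.2 ⟨C, ?_⟩
  rintro _ ⟨z, rfl⟩
  -- The first component `0` keeps the translate of `(w, 0)` in the fibre over `w`.
  obtain ⟨c, hc⟩ := D.latticeMap_surjective (0, z)
  have h := hC c
  rw [latticeVec, hc] at h
  simpa using h

theorem exists_eq_const_of_invariant {F : ℂ × (Fin n → ℂ) → ℂ}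
    (hF : DifferentiableOn ℂ F (upperDomain n))
    (hinv : ∀ q ∈ upperDomain n, ∀ c : Fin (2 * n + 1) → ℤ,
      F (q + D.latticeVec (fun i ↦ (c i : ℝ))) = F q) : ∃ C, ∀ q ∈ upperDomain n, F q = C := by
  have hG : DifferentiableOn ℂ (fun w : ℂ ↦ F (w, 0)) {w | 0 < w.im} :=
    hF.comp (differentiable_id.prodMk (differentiable_const _)).differentiableOn fun w hw ↦ hw
  have hopen : IsOpen {w : ℂ | 0 < w.im} := isOpen_lt continuous_const Complex.continuous_im
  have htrans : ∀ w : ℂ, 0 < w.im → ∀ t : ℝ, F (w + t, 0) = F (w, 0) := by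
    intro w hw
    have hc : Continuous fun t : ℝ ↦ F (w + t, 0) :=
      hG.continuousOn.comp_continuous (by fun_prop) fun t ↦ by simpa using hw
    refine congrFun (hc.ext_on D.dense_coordSubgroup continuous_const ?_)
    rintro _ ⟨c, rfl⟩
    -- A lattice translation also moves `z`; independence of `z` moves it back to `0`.
    rw [← hinv (w, 0) hw c]
    exact D.eq_of_fst_eq hF hinv (by simpa using hw) _ _
  -- The complex derivative is read off along the horizontal line `t ↦ w + t`, on which the function
  -- is constant.
  have hderiv : Set.EqOn (deriv fun w : ℂ ↦ F (w, 0)) 0 {w | 0 < w.im} := by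
    intro w hw
    have h1 : HasDerivAt (fun w : ℂ ↦ F (w, 0)) (deriv (fun w : ℂ ↦ F (w, 0)) w)
        (w + (0 : ℝ)) := by
      simpa using (hG.differentiableAt (hopen.mem_nhds hw)).hasDerivAt
    have h2 : HasDerivAt (fun t : ℝ ↦ w + (t : ℂ)) 1 0 :=
      (HasDerivAt.ofReal_comp (hasDerivAt_id (0 : ℝ))).const_add w
    have h3 := HasDerivAt.comp (𝕜 := ℝ) (𝕜' := ℂ) (0 : ℝ) h1 h2
    have h4 : ((fun w : ℂ ↦ F (w, 0)) ∘ fun t : ℝ ↦ w + (t : ℂ)) = fun _ ↦ F (w, 0) :=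
      funext fun t ↦ htrans w hw t
    rw [h4] at h3
    simpa using h3.unique (hasDerivAt_const _ _)
  have hconv : Convex ℝ {w : ℂ | 0 < w.im} := convex_halfSpace_im_gt 0
  refine ⟨F (Complex.I, 0), fun q hq ↦ ?_⟩
  rw [show F q = F (q.1, 0) from D.eq_of_fst_eq hF hinv hq q.2 0]
  exact hopen.is_const_of_deriv_eq_zero hconv.isPreconnected hG hderiv hq (by simp)

/-! ### The projection to `T_M` in charts -/

/-- The projection `ℍ × ℂⁿ → T_M`, as a function on `ℂ × ℂⁿ`. -/
def proj (q : ℂ × (Fin n → ℂ)) : D.TM :=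
  Quotient.mk (MulAction.orbitRel D.GM (ℍ × (Fin n → ℂ))) (UpperHalfPlane.ofComplex q.1, q.2)

/-- The inclusion of `ℍ × ℂⁿ` in `ℂ × ℂⁿ`. -/
def incl (p : ℍ × (Fin n → ℂ)) : ℂ × (Fin n → ℂ) := (p.1, p.2)

theorem incl_ofComplex {q : ℂ × (Fin n → ℂ)} (hq : q ∈ upperDomain n) :
    incl (UpperHalfPlane.ofComplex q.1, q.2) = q := by
  have h : 0 < q.1.im := hq
  simp [incl, UpperHalfPlane.ofComplex_apply_of_im_pos h]

theorem incl_mem (p : ℍ × (Fin n → ℂ)) : incl p ∈ upperDomain n := p.1.im_pos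

theorem proj_incl (p : ℍ × (Fin n → ℂ)) :
    D.proj (incl p) = Quotient.mk (MulAction.orbitRel D.GM (ℍ × (Fin n → ℂ))) p := by
  simp [proj, incl]

theorem mk_smul (γ : Equiv.Perm (ℍ × (Fin n → ℂ))) (hγ : γ ∈ D.GM) (p : ℍ × (Fin n → ℂ)) :
    (Quotient.mk (MulAction.orbitRel D.GM (ℍ × (Fin n → ℂ))) (γ p) : D.TM) =
      Quotient.mk (MulAction.orbitRel D.GM (ℍ × (Fin n → ℂ))) p :=
  Quotient.sound (MulAction.orbitRel_apply.2 ⟨⟨γ, hγ⟩, rfl⟩)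

theorem g₀_mem : D.g₀ ∈ D.GM := Subgroup.subset_closure (Set.mem_insert _ _)

theorem trans_mem (c : Fin (2 * n + 1) → ℤ) : D.trans c ∈ D.GM := by
  have hg : ∀ i, D.trans (Pi.single i 1) ∈ D.GM := fun i ↦ by
    rw [← g_eq_trans]
    exact Subgroup.subset_closure (Set.mem_insert_of_mem _ ⟨i, rfl⟩)
  -- Once the admissible `c` form a subgroup, it suffices to treat the standard basis vectors.
  let S : AddSubgroup (Fin (2 * n + 1) → ℤ) :=
    { carrier := {c | D.trans c ∈ D.GM}
      add_mem' := fun {c d} hc hd ↦ by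
        rw [Set.mem_ofPred_eq, trans_add]
        exact mul_mem hc hd
      zero_mem' := by
        rw [Set.mem_ofPred_eq, trans_zero]
        exact one_mem _
      neg_mem' := fun {c} hc ↦ by
        rw [Set.mem_ofPred_eq, trans_neg]
        exact inv_mem hc }
  change c ∈ S
  rw [pi_eq_sum_univ' c]
  exact sum_mem fun i _ ↦ zsmul_mem (show Pi.single i 1 ∈ S from hg i) _

theorem proj_add_latticeVec {q : ℂ × (Fin n → ℂ)} (hq : q ∈ upperDomain n)
    (c : Fin (2 * n + 1) → ℤ) : D.proj (q + D.latticeVec (fun i ↦ (c i : ℝ))) = D.proj q := by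
  rw [← incl_ofComplex hq, proj_incl, ← D.mk_smul _ (D.trans_mem c), ← proj_incl]
  congr 1
  rw [trans_apply]
  simp [incl, latticeVec, add_comm]

theorem proj_scale {q : ℂ × (Fin n → ℂ)} (hq : q ∈ upperDomain n) :
    D.proj (D.scale q) = D.proj q := by
  rw [← incl_ofComplex hq, proj_incl, ← D.mk_smul _ D.g₀_mem, ← proj_incl]
  congr 1

theorem exists_affine_of_mem {γ : Equiv.Perm (ℍ × (Fin n → ℂ))} (hγ : γ ∈ D.GM) :
    ∃ (B : ℂ × (Fin n → ℂ) →L[ℂ] ℂ × (Fin n → ℂ)) (v : ℂ × (Fin n → ℂ)),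
      ∀ p, incl (γ p) = B (incl p) + v := by
  induction hγ using Subgroup.closure_induction'' with
  | mem x hx =>
    rcases hx with rfl | ⟨i, rfl⟩
    · refine ⟨D.scale, 0, fun p ↦ ?_⟩
      rw [add_zero]
      rfl
    · exact ⟨ContinuousLinearMap.id ℂ _, (D.a i, D.bvec i), fun p ↦ by
        simp [incl, g, add_comm]⟩
  | inv_mem x hx =>
    rcases hx with rfl | ⟨i, rfl⟩
    · refine ⟨LinearMap.toContinuousLinearMap
        (((D.α⁻¹ : ℂ) • LinearMap.id).prodMap (Matrix.toLin' D.Rᵀ⁻¹)), 0, fun p ↦ ?_⟩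
      simp [incl, g₀, Equiv.Perm.inv_def]
    · exact ⟨ContinuousLinearMap.id ℂ _, (-(D.a i : ℂ), -D.bvec i), fun p ↦ by
        simp [incl, g, Equiv.Perm.inv_def, sub_eq_add_neg, add_comm]⟩
  | one => exact ⟨ContinuousLinearMap.id ℂ _, 0, fun p ↦ by simp⟩
  | mul x y _ _ hx hy =>
    obtain ⟨B, v, h⟩ := hx
    obtain ⟨B', v', h'⟩ := hy
    refine ⟨B ∘L B', B v' + v, fun p ↦ ?_⟩
    rw [Equiv.Perm.mul_apply, h, h', map_add, add_assoc]
    rfl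

/-- Two lifts of one point differ by an element of `G_M`, which acts affinely and does not change
the projection. -/
theorem exists_affine_of_proj_eq {q r : ℂ × (Fin n → ℂ)} (hq : q ∈ upperDomain n)
    (hr : r ∈ upperDomain n) (h : D.proj r = D.proj q) :
    ∃ (B : ℂ × (Fin n → ℂ) →L[ℂ] ℂ × (Fin n → ℂ)) (v : ℂ × (Fin n → ℂ)),
      B q + v = r ∧ ∀ q' ∈ upperDomain n, D.proj (B q' + v) = D.proj q' := by
  obtain ⟨⟨γ, hγ⟩, h1⟩ := MulAction.orbitRel_apply.1 (Quotient.exact h)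
  obtain ⟨B, v, hB⟩ := D.exists_affine_of_mem hγ
  refine ⟨B, v, ?_, fun q' hq' ↦ ?_⟩
  · rw [← incl_ofComplex hq, ← hB, ← incl_ofComplex hr]
    exact congrArg incl h1
  · rw [← incl_ofComplex hq', ← hB, proj_incl, proj_incl, D.mk_smul _ hγ]

theorem chartAt_apply (y p : ℍ × (Fin n → ℂ)) :
    chartAt (ModelProd ℂ (Fin n → ℂ)) y p = incl p := rfl

/-- A chart of the quotient is a local inverse of the quotient map followed by a coordinate chart of
`ℍ × ℂⁿ`, so its inverse is the quotient map in coordinates. -/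
theorem exists_of_mem_target {x : D.TM} {q : ℂ × (Fin n → ℂ)}
    (hq : q ∈ (extChartAt (model n) x).target) :
    ∃ p, incl p = q ∧ (extChartAt (model n) x).symm q =
      Quotient.mk (MulAction.orbitRel D.GM (ℍ × (Fin n → ℂ))) p := by
  have hcov : IsLocalHomeomorph (Quotient.mk (MulAction.orbitRel D.GM (ℍ × (Fin n → ℂ)))) :=
    (isQuotientCoveringMap_quotientMk_of_properlyDiscontinuousSMul
      (E := ℍ × (Fin n → ℂ)) (G := D.GM)).isCoveringMap.isLocalHomeomorph
  obtain ⟨y, hy⟩ : ∃ y, (hcov.localInverseAt y).trans (chartAt (ModelProd ℂ (Fin n → ℂ)) y) =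
      chartAt (ModelProd ℂ (Fin n → ℂ)) x := by
    obtain ⟨z, hz⟩ := chart_mem_atlas (ModelProd ℂ (Fin n → ℂ)) x
    exact ⟨_, hz⟩
  rw [extChartAt_target, ← hy, OpenPartialHomeomorph.trans_target] at hq
  have hq1 : q ∈ (chartAt (ModelProd ℂ (Fin n → ℂ)) y).target := hq.1.1
  refine ⟨(chartAt (ModelProd ℂ (Fin n → ℂ)) y).symm q, ?_, ?_⟩
  · rw [← chartAt_apply y]
    exact (chartAt (ModelProd ℂ (Fin n → ℂ)) y).right_inv hq1
  · rw [extChartAt_coe_symm, ← hy, Function.comp_apply, OpenPartialHomeomorph.coe_trans_symm,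
      hcov.localInverseAt_symm]
    rfl

theorem mem_upperDomain_of_mem_target {x : D.TM} {q : ℂ × (Fin n → ℂ)}
    (hq : q ∈ (extChartAt (model n) x).target) : q ∈ upperDomain n := by
  obtain ⟨p, rfl, -⟩ := D.exists_of_mem_target hq
  exact incl_mem p

theorem extChartAt_symm_eq_proj {x : D.TM} {q : ℂ × (Fin n → ℂ)}
    (hq : q ∈ (extChartAt (model n) x).target) :
    (extChartAt (model n) x).symm q = D.proj q := by
  obtain ⟨p, rfl, h⟩ := D.exists_of_mem_target hq
  rw [h, proj_incl]

/-- The chart picks a lift of `proj q` that may differ from `q`; the element of `G_M` relating the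
two lifts expresses the chart near `q`. That it is affine makes the Jacobian `B` constant there. -/
theorem eventually_extChartAt_proj {x : D.TM} {q : ℂ × (Fin n → ℂ)} (hq : q ∈ upperDomain n)
    (hx : D.proj q ∈ (extChartAt (model n) x).source) :
    ∃ (B : ℂ × (Fin n → ℂ) →L[ℂ] ℂ × (Fin n → ℂ)) (v : ℂ × (Fin n → ℂ)), ∀ᶠ q' in 𝓝 q,
      D.proj q' ∈ (extChartAt (model n) x).source ∧ B q' + v ∈ (extChartAt (model n) x).target ∧
      extChartAt (model n) x (D.proj q') = B q' + v := by
  have hr := (extChartAt (model n) x).map_source hx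
  have hsymm := (extChartAt (model n) x).left_inv hx
  rw [D.extChartAt_symm_eq_proj hr] at hsymm
  obtain ⟨B, v, hBq, hB⟩ := D.exists_affine_of_proj_eq hq (D.mem_upperDomain_of_mem_target hr) hsymm
  refine ⟨B, v, ?_⟩
  have hc : Continuous fun q' ↦ B q' + v := B.continuous.add continuous_const
  have hev : ∀ᶠ q' in 𝓝 q, B q' + v ∈ (extChartAt (model n) x).target :=
    hc.continuousAt ((isOpen_extChartAt_target x).mem_nhds (by simpa only [hBq] using hr))
  filter_upwards [hev, (isOpen_upperDomain n).mem_nhds hq] with q' h1 h2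
  have h3 := D.extChartAt_symm_eq_proj h1
  rw [hB q' h2] at h3
  rw [← h3]
  exact ⟨(extChartAt (model n) x).map_target h1, h1, (extChartAt (model n) x).right_inv h1⟩

theorem eventually_extChartAt_proj_self {x : D.TM} {q : ℂ × (Fin n → ℂ)}
    (hq : q ∈ (extChartAt (model n) x).target) :
    ∀ᶠ q' in 𝓝 q, extChartAt (model n) x (D.proj q') = q' := by
  filter_upwards [(isOpen_extChartAt_target x).mem_nhds hq] with q' h
  rw [← D.extChartAt_symm_eq_proj h, (extChartAt (model n) x).right_inv h]

theorem contMDiffAt_proj {q : ℂ × (Fin n → ℂ)} (hq : q ∈ upperDomain n) :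
    ContMDiffAt 𝓘(ℂ, ℂ × (Fin n → ℂ)) (model n) ω D.proj q := by
  obtain ⟨B, v, hB⟩ := D.eventually_extChartAt_proj hq (mem_extChartAt_source (D.proj q))
  have h1 : ContMDiffAt 𝓘(ℂ, ℂ × (Fin n → ℂ)) (model n) ω
      (extChartAt (model n) (D.proj q)).symm (B q + v) := by
    have h := contMDiffOn_extChartAt_symm (I := model n) (n := ω) (D.proj q)
    exact h.contMDiffAt ((isOpen_extChartAt_target _).mem_nhds hB.self_of_nhds.2.1)
  have h2 : ContMDiffAt 𝓘(ℂ, ℂ × (Fin n → ℂ)) 𝓘(ℂ, ℂ × (Fin n → ℂ)) ω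
      (fun q' ↦ B q' + v) q :=
    (B.contDiff.add contDiff_const).contMDiff.contMDiffAt
  refine (h1.comp q h2).congr_of_eventuallyEq ?_
  filter_upwards [hB] with q' h
  rw [Function.comp_apply, ← h.2.2, (extChartAt (model n) (D.proj q)).left_inv h.1]

theorem mdifferentiableAt_proj {q : ℂ × (Fin n → ℂ)} (hq : q ∈ upperDomain n) :
    MDifferentiableAt 𝓘(ℂ, ℂ × (Fin n → ℂ)) (model n) D.proj q :=
  (D.contMDiffAt_proj hq).mdifferentiableAt (by simp)

theorem mfderiv_extChartAt_comp_mfderiv_proj {x : D.TM} {q : ℂ × (Fin n → ℂ)}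
    (hq : q ∈ upperDomain n) (hx : D.proj q ∈ (extChartAt (model n) x).source)
    {B : ℂ × (Fin n → ℂ) →L[ℂ] ℂ × (Fin n → ℂ)} {v : ℂ × (Fin n → ℂ)}
    (hB : ∀ᶠ q' in 𝓝 q, extChartAt (model n) x (D.proj q') = B q' + v) :
    (mfderiv (model n) 𝓘(ℂ, ℂ × (Fin n → ℂ)) (extChartAt (model n) x) (D.proj q)) ∘L
      (mfderiv 𝓘(ℂ, ℂ × (Fin n → ℂ)) (model n) D.proj q) = B := by
  have h1 : MDifferentiableAt (model n) 𝓘(ℂ, ℂ × (Fin n → ℂ)) (extChartAt (model n) x)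
      (D.proj q) := mdifferentiableAt_extChartAt (by simpa using hx)
  rw [← mfderiv_comp q h1 (D.mdifferentiableAt_proj hq)]
  have h2 : (extChartAt (model n) x ∘ D.proj) =ᶠ[𝓝 q] fun q' ↦ B q' + v := hB
  rw [h2.mfderiv_eq, mfderiv_eq_fderiv]
  exact (B.hasFDerivAt.add_const v).fderiv

/-! ### Holomorphic 1-forms -/

open ComplexManifold

/-- The pull-back to `ℂ × ℂⁿ` of a field of linear forms on `T_M`. -/
def pullForm (l : ∀ x : D.TM, TangentSpace (model n) x →L[ℂ] ℂ) (q : ℂ × (Fin n → ℂ)) :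
    ℂ × (Fin n → ℂ) →L[ℂ] ℂ :=
  (l (D.proj q)) ∘L (mfderiv 𝓘(ℂ, ℂ × (Fin n → ℂ)) (model n) D.proj q)

/-- This is the chain rule for `proj (A q' + v) = proj q'`. The two derivatives land in tangent
spaces at formally different points, so both are viewed as maps to the model space. -/
theorem mfderiv_proj_comp {q v : ℂ × (Fin n → ℂ)}
    {A : ℂ × (Fin n → ℂ) →L[ℂ] ℂ × (Fin n → ℂ)} (hq : q ∈ upperDomain n)
    (hAq : A q + v ∈ upperDomain n)
    (hA : ∀ q' ∈ upperDomain n, D.proj (A q' + v) = D.proj q') :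
    (mfderiv 𝓘(ℂ, ℂ × (Fin n → ℂ)) (model n) D.proj (A q + v) :
      ℂ × (Fin n → ℂ) →L[ℂ] ℂ × (Fin n → ℂ)) ∘L A =
      mfderiv 𝓘(ℂ, ℂ × (Fin n → ℂ)) (model n) D.proj q := by
  have h1 : (fun q' ↦ D.proj (A q' + v)) =ᶠ[𝓝 q] D.proj := by
    filter_upwards [(isOpen_upperDomain n).mem_nhds hq] with q' h using hA q' h
  have h2 : HasMFDerivAt 𝓘(ℂ, ℂ × (Fin n → ℂ)) 𝓘(ℂ, ℂ × (Fin n → ℂ)) (fun q' ↦ A q' + v) q A :=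
    (A.hasFDerivAt.add_const v).hasMFDerivAt
  have h3 := (D.mdifferentiableAt_proj hAq).hasMFDerivAt.comp q h2
  exact (h3.congr_of_eventuallyEq h1.symm).mfderiv.symm

theorem form_congr (l : ∀ x : D.TM, TangentSpace (model n) x →L[ℂ] ℂ) {x y : D.TM} (h : x = y) :
    (l x : ℂ × (Fin n → ℂ) →L[ℂ] ℂ) = l y := by
  subst h
  rfl

theorem pullForm_comp (l : ∀ x : D.TM, TangentSpace (model n) x →L[ℂ] ℂ) {q v : ℂ × (Fin n → ℂ)}
    {A : ℂ × (Fin n → ℂ) →L[ℂ] ℂ × (Fin n → ℂ)} (hq : q ∈ upperDomain n)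
    (hAq : A q + v ∈ upperDomain n)
    (hA : ∀ q' ∈ upperDomain n, D.proj (A q' + v) = D.proj q') :
    D.pullForm l (A q + v) ∘L A = D.pullForm l q := by
  have h1 : (l (D.proj (A q + v)) : ℂ × (Fin n → ℂ) →L[ℂ] ℂ) = l (D.proj q) :=
    D.form_congr l (hA q hq)
  have h2 := D.mfderiv_proj_comp hq hAq hA
  unfold pullForm
  rw [← h2, ← h1]
  rfl

/-- The function is the pairing of two differentiable sections along `proj`: the form `l`, and the
image under the derivative of `proj` of the constant vector field `e`. -/
theorem differentiableOn_pullForm {l : ∀ x : D.TM, TangentSpace (model n) x →L[ℂ] ℂ}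
    (hl : IsHolomorphicOneForm (model n) l) (e : ℂ × (Fin n → ℂ)) :
    DifferentiableOn ℂ (fun q ↦ D.pullForm l q e) (upperDomain n) := by
  intro q hq
  apply DifferentiableAt.differentiableWithinAt
  -- Class `C²` is what makes the tangent map of class `C¹`.
  have hproj : ContMDiffOn 𝓘(ℂ, ℂ × (Fin n → ℂ)) (model n) 2 D.proj (upperDomain n) :=
    fun q hq ↦ ((D.contMDiffAt_proj hq).of_le le_top).contMDiffWithinAt
  have hT := hproj.contMDiffOn_tangentMapWithin (m := 1) (by norm_num)
    (isOpen_upperDomain n).uniqueMDiffOn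
  have hsec : ContMDiff 𝓘(ℂ, ℂ × (Fin n → ℂ)) 𝓘(ℂ, ℂ × (Fin n → ℂ)).tangent 1
      (fun q ↦ (⟨q, e⟩ : TangentBundle 𝓘(ℂ, ℂ × (Fin n → ℂ)) (ℂ × (Fin n → ℂ)))) := fun q ↦
    contMDiffAt_vectorSpace_iff_contDiffAt.2 contDiffAt_const
  have hv : MDifferentiableAt 𝓘(ℂ, ℂ × (Fin n → ℂ)) (model n).tangent
      (fun q ↦ (⟨D.proj q, mfderiv 𝓘(ℂ, ℂ × (Fin n → ℂ)) (model n) D.proj q e⟩ :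
        TangentBundle (model n) D.TM)) q := by
    have h1 := (hT.comp hsec.contMDiffOn (s := upperDomain n) (fun q hq ↦ hq)).contMDiffAt
      ((isOpen_upperDomain n).mem_nhds hq)
    refine (h1.mdifferentiableAt one_ne_zero).congr_of_eventuallyEq ?_
    filter_upwards [(isOpen_upperDomain n).mem_nhds hq] with q' hq'
    simp only [Function.comp_apply, tangentMapWithin]
    rw [mfderivWithin_of_isOpen (isOpen_upperDomain n) hq']
  have hφ := (hl (D.proj q)).comp q (D.mdifferentiableAt_proj hq)
  have h := MDifferentiableAt.clm_bundle_apply (F₁ := ℂ × (Fin n → ℂ)) (F₂ := ℂ) (b := D.proj)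
    (E₁ := fun x : D.TM ↦ TangentSpace (model n) x) (E₂ := Bundle.Trivial D.TM ℂ) hφ hv
  rw [mdifferentiableAt_totalSpace] at h
  exact mdifferentiableAt_iff_differentiableAt.1 h.2

/-- Near `x` the projection is a left inverse of the chart, so every tangent vector at `x` is in the
image of the derivative of `proj`. -/
theorem eq_zero_of_pullForm_eq_zero {l : ∀ x : D.TM, TangentSpace (model n) x →L[ℂ] ℂ}
    (hl : ∀ q ∈ upperDomain n, D.pullForm l q = 0) : l = 0 := by
  funext x
  have hx := mem_extChartAt_source (I := model n) x
  have hq := (extChartAt (model n) x).map_source hx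
  set q := extChartAt (model n) x x with hqdef
  have hqU := D.mem_upperDomain_of_mem_target hq
  have hpx : D.proj q = x := by
    rw [← D.extChartAt_symm_eq_proj hq, hqdef, (extChartAt (model n) x).left_inv hx]
  have h1 : (D.proj ∘ extChartAt (model n) x) =ᶠ[𝓝 x] id := by
    filter_upwards [extChartAt_source_mem_nhds (I := model n) x] with y hy
    rw [Function.comp_apply, ← D.extChartAt_symm_eq_proj ((extChartAt (model n) x).map_source hy),
      (extChartAt (model n) x).left_inv hy, id]
  have h2 : MDifferentiableAt (model n) 𝓘(ℂ, ℂ × (Fin n → ℂ)) (extChartAt (model n) x) x :=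
    mdifferentiableAt_extChartAt (by simp)
  have h3 := ((D.mdifferentiableAt_proj hqU).hasMFDerivAt.comp x h2.hasMFDerivAt)
  have h4 := (h3.congr_of_eventuallyEq h1.symm).mfderiv
  rw [mfderiv_id] at h4
  have h5 : (l (D.proj q) : ℂ × (Fin n → ℂ) →L[ℂ] ℂ) = l x :=
    D.form_congr l hpx
  refine ContinuousLinearMap.ext fun e ↦ ?_
  have h6 := DFunLike.congr_fun (hl q hqU)
    (mfderiv (model n) 𝓘(ℂ, ℂ × (Fin n → ℂ)) (extChartAt (model n) x) x e)
  have h7 := DFunLike.congr_fun h4 e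
  have h8 := DFunLike.congr_fun h5 e
  refine h8.symm.trans ((congrArg (l (D.proj q) : ℂ × (Fin n → ℂ) →L[ℂ] ℂ) h7).trans h6)

theorem eq_zero_of_isHolomorphicOneForm {l : ∀ x : D.TM, TangentSpace (model n) x →L[ℂ] ℂ}
    (hl : IsHolomorphicOneForm (model n) l) : l = 0 := by
  have hconst : ∀ e, ∃ C, ∀ q ∈ upperDomain n, D.pullForm l q e = C := by
    refine fun e ↦ D.exists_eq_const_of_invariant (D.differentiableOn_pullForm hl e) ?_
    intro q hq c
    have h := D.pullForm_comp l (A := ContinuousLinearMap.id ℂ _) hq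
      (D.add_latticeVec_mem hq _) (fun q' hq' ↦ D.proj_add_latticeVec hq' c)
    exact DFunLike.congr_fun h e
  refine D.eq_zero_of_pullForm_eq_zero fun q hq ↦ D.eq_zero_of_comp_scale_eq ?_
  have h := D.pullForm_comp l (A := D.scale) (v := 0) hq (by simpa using D.scale_mem hq)
    (fun q' hq' ↦ by simpa using D.proj_scale hq')
  rw [add_zero] at h
  -- The coefficients are constant, so the pulled-back form is the same at `q` and at `scale q`, and
  -- its invariance becomes the fixed-covector equation.
  refine Eq.trans ?_ h
  congr 1
  refine ContinuousLinearMap.ext fun e ↦ ?_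
  obtain ⟨C, hC⟩ := hconst e
  rw [hC q hq, hC _ (D.scale_mem hq)]

/-! ### Pluricanonical sections -/

/-- The linear form on `(⋀ᵐ V*)^{⊗ k}` which multiplies the values of the factors at
`(u₁, …, u_m)`. -/
def evalTensor {V : Type*} [AddCommGroup V] [Module ℂ V] {m : ℕ} (k : ℕ) (u : Fin m → V) :
    ⨂[ℂ]^k (V [⋀^Fin m]→ₗ[ℂ] ℂ) →ₗ[ℂ] ℂ :=
  PiTensorProduct.lift ((MultilinearMap.mkPiAlgebra ℂ (Fin k) ℂ).compLinearMap fun _ ↦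
    { toFun := fun f ↦ f u
      map_add' := fun _ _ ↦ rfl
      map_smul' := fun _ _ ↦ rfl })

theorem evalTensor_tprod {V : Type*} [AddCommGroup V] [Module ℂ V] {m : ℕ} (k : ℕ)
    (u : Fin m → V) (f : V [⋀^Fin m]→ₗ[ℂ] ℂ) :
    evalTensor k u (PiTensorProduct.tprod ℂ fun _ : Fin k ↦ f) = f u ^ k := by
  simp [evalTensor]

/-- The coefficient of the pull-back to `ℂ × ℂⁿ` of a field of elements of the fibres of
`K^{⊗ k}`. -/
def pullCoeff {k : ℕ} (s : ∀ x : D.TM, PluricanonicalFiber (model n) k x)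
    (q : ℂ × (Fin n → ℂ)) : ℂ :=
  evalTensor k (V := TangentSpace (model n) (D.proj q))
    (fun i ↦ mfderiv 𝓘(ℂ, ℂ × (Fin n → ℂ)) (model n) D.proj q
      (Module.finBasis ℂ (ℂ × (Fin n → ℂ)) i)) (s (D.proj q))

/-- By the chain rule the coordinate volume form takes on the projected basis vectors the value `det
B`, once for each of the `k` tensor factors. -/
theorem pullCoeff_eq {k : ℕ} {s : ∀ x : D.TM, PluricanonicalFiber (model n) k x} {x : D.TM}
    {f : ℂ × (Fin n → ℂ) → ℂ} (hs : ∀ y ∈ (extChartAt (model n) x).source,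
      s y = f (extChartAt (model n) x y) •
        PiTensorProduct.tprod ℂ (fun _ : Fin k ↦ coordVolume (model n) x y))
    {q : ℂ × (Fin n → ℂ)} (hq : q ∈ upperDomain n)
    (hx : D.proj q ∈ (extChartAt (model n) x).source)
    {B : ℂ × (Fin n → ℂ) →L[ℂ] ℂ × (Fin n → ℂ)} {v : ℂ × (Fin n → ℂ)}
    (hB : ∀ᶠ q' in 𝓝 q, extChartAt (model n) x (D.proj q') = B q' + v) :
    D.pullCoeff s q = f (B q + v) *
      LinearMap.det (B : ℂ × (Fin n → ℂ) →ₗ[ℂ] ℂ × (Fin n → ℂ)) ^ k := by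
  have h := D.mfderiv_extChartAt_comp_mfderiv_proj hq hx hB
  rw [pullCoeff, hs _ hx, map_smul, evalTensor_tprod, smul_eq_mul, hB.self_of_nhds]
  congr 2
  have h1 := (Module.finBasis ℂ (ℂ × (Fin n → ℂ))).det_comp
    (B : ℂ × (Fin n → ℂ) →ₗ[ℂ] ℂ × (Fin n → ℂ)) (Module.finBasis ℂ (ℂ × (Fin n → ℂ)))
  rw [Module.Basis.det_self, mul_one] at h1
  rw [← h1]
  refine congrArg (Module.finBasis ℂ (ℂ × (Fin n → ℂ))).det (funext fun i ↦ ?_)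
  exact DFunLike.congr_fun h (Module.finBasis ℂ (ℂ × (Fin n → ℂ)) i)

/-- Both coefficients are computed in one chart: if its expression near `A q + v` has linear part
`B`, then near `q` it has linear part `B ∘ A`, and determinants multiply. -/
theorem pullCoeff_affine {k : ℕ} {s : ∀ x : D.TM, PluricanonicalFiber (model n) k x}
    (hs : s ∈ pluricanonicalSections (model n) D.TM k) {q v : ℂ × (Fin n → ℂ)}
    {A : ℂ × (Fin n → ℂ) →L[ℂ] ℂ × (Fin n → ℂ)} (hq : q ∈ upperDomain n)
    (hAq : A q + v ∈ upperDomain n)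
    (hA : ∀ q' ∈ upperDomain n, D.proj (A q' + v) = D.proj q') :
    D.pullCoeff s (A q + v) * LinearMap.det (A : ℂ × (Fin n → ℂ) →ₗ[ℂ] ℂ × (Fin n → ℂ)) ^ k =
      D.pullCoeff s q := by
  obtain ⟨f, -, hf⟩ := hs (D.proj q)
  have hx := mem_extChartAt_source (I := model n) (D.proj q)
  have hx' : D.proj (A q + v) ∈ (extChartAt (model n) (D.proj q)).source := by rwa [hA q hq]
  obtain ⟨B, u, hB⟩ := D.eventually_extChartAt_proj hAq hx'
  have h1 := D.pullCoeff_eq hf hAq hx' (hB.mono fun _ h ↦ h.2.2)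
  have h2 : ∀ᶠ q' in 𝓝 q, extChartAt (model n) (D.proj q) (D.proj q') =
      (B ∘L A) q' + (B v + u) := by
    have hc : ContinuousAt (fun q' ↦ A q' + v) q := (A.continuous.add continuous_const).continuousAt
    filter_upwards [hc.eventually hB, (isOpen_upperDomain n).mem_nhds hq] with q' h3 h4
    rw [← hA q' h4, h3.2.2, map_add, add_assoc]
    rfl
  have h3 : LinearMap.det ((B ∘L A : ℂ × (Fin n → ℂ) →L[ℂ] ℂ × (Fin n → ℂ)) :
      ℂ × (Fin n → ℂ) →ₗ[ℂ] ℂ × (Fin n → ℂ)) =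
        LinearMap.det (B : ℂ × (Fin n → ℂ) →ₗ[ℂ] ℂ × (Fin n → ℂ)) *
          LinearMap.det (A : ℂ × (Fin n → ℂ) →ₗ[ℂ] ℂ × (Fin n → ℂ)) :=
    LinearMap.det_comp (B : ℂ × (Fin n → ℂ) →ₗ[ℂ] ℂ × (Fin n → ℂ))
      (A : ℂ × (Fin n → ℂ) →ₗ[ℂ] ℂ × (Fin n → ℂ))
  rw [h1, D.pullCoeff_eq hf hq hx h2, h3, mul_pow, map_add, mul_assoc, add_assoc]
  rfl

theorem differentiableOn_pullCoeff {k : ℕ} {s : ∀ x : D.TM, PluricanonicalFiber (model n) k x}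
    (hs : s ∈ pluricanonicalSections (model n) D.TM k) :
    DifferentiableOn ℂ (D.pullCoeff s) (upperDomain n) := by
  intro q hq
  apply DifferentiableAt.differentiableWithinAt
  obtain ⟨f, hfd, hf⟩ := hs (D.proj q)
  obtain ⟨B, v, hB⟩ := D.eventually_extChartAt_proj hq (mem_extChartAt_source (D.proj q))
  have hfq : DifferentiableAt ℂ f (B q + v) := hfd.differentiableAt
    ((isOpen_extChartAt_target _).mem_nhds hB.self_of_nhds.2.1)
  have hd : DifferentiableAt ℂ (fun q' ↦ f (B q' + v) *
      LinearMap.det (B : ℂ × (Fin n → ℂ) →ₗ[ℂ] ℂ × (Fin n → ℂ)) ^ k) q :=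
    (hfq.comp q (B.differentiableAt.add_const v)).mul_const _
  refine hd.congr_of_eventuallyEq ?_
  -- The coefficient at `q'` involves a derivative, so the affine expression is needed on a
  -- neighbourhood of each nearby `q'`.
  filter_upwards [hB.eventually_nhds, (isOpen_upperDomain n).mem_nhds hq] with q' h1 h2
  exact D.pullCoeff_eq hf h2 h1.self_of_nhds.1 (h1.mono fun _ h ↦ h.2.2)

/-- At the lift of `x` given by its own chart, the chart expression is the identity, so the
pulled-back coefficient is the local coefficient `f` itself. -/
theorem eq_zero_of_pullCoeff_eq_zero {k : ℕ} {s : ∀ x : D.TM, PluricanonicalFiber (model n) k x}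
    (hs : s ∈ pluricanonicalSections (model n) D.TM k)
    (h0 : ∀ q ∈ upperDomain n, D.pullCoeff s q = 0) : s = 0 := by
  funext x
  obtain ⟨f, -, hf⟩ := hs x
  have hx := mem_extChartAt_source (I := model n) x
  have hq := (extChartAt (model n) x).map_source hx
  have hqU := D.mem_upperDomain_of_mem_target hq
  have hpx : D.proj (extChartAt (model n) x x) = x := by
    rw [← D.extChartAt_symm_eq_proj hq, (extChartAt (model n) x).left_inv hx]
  have h1 := D.pullCoeff_eq hf hqU (by rwa [hpx]) (B := ContinuousLinearMap.id ℂ _) (v := 0)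
    ((D.eventually_extChartAt_proj_self hq).mono fun q' h ↦ by simpa using h)
  rw [h0 _ hqU] at h1
  have h2 : f (extChartAt (model n) x x) = 0 := by simpa using h1.symm
  rw [hf x hx, h2, zero_smul]
  rfl

theorem pluricanonicalSections_eq_bot {k : ℕ} (hk : 0 < k) :
    pluricanonicalSections (model n) D.TM k = ⊥ := by
  rw [eq_bot_iff]
  intro s hs
  rw [Submodule.mem_bot]
  obtain ⟨C, hC⟩ := D.exists_eq_const_of_invariant (D.differentiableOn_pullCoeff hs) (by
    intro q hq c
    have h := D.pullCoeff_affine hs (A := ContinuousLinearMap.id ℂ _) hq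
      (D.add_latticeVec_mem hq _) (fun q' hq' ↦ D.proj_add_latticeVec hq' c)
    simpa using h)
  refine D.eq_zero_of_pullCoeff_eq_zero hs fun q hq ↦ ?_
  have h := D.pullCoeff_affine hs (A := D.scale) (v := 0) hq (by simpa using D.scale_mem hq)
    (fun q' hq' ↦ by simpa using D.proj_scale hq')
  -- With a constant coefficient, invariance under `g₀` reads `C * (α det R) ^ k = C`.
  rw [add_zero, hC _ (D.scale_mem hq), hC q hq, D.det_scale] at h
  rw [hC q hq]
  by_contra hne
  exact D.alpha_mul_det_R_pow_ne_one hk (mul_left_cancel₀ hne (by rw [h, mul_one]))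

theorem kodairaDimension_eq_bot : kodairaDimension (model n) D.TM = ⊥ := by
  rw [kodairaDimension, if_pos]
  intro k hk
  rw [plurigenus, D.pluricanonicalSections_eq_bot hk, rank_bot, map_zero]

end InoueData

end

theorem proposition4p2 {n : ℕ} (hn : 0 < n) (D : InoueData n) :
    (∀ l : ∀ x : D.TM, TangentSpace (InoueData.model n) x →L[ℂ] ℂ,
      ComplexManifold.IsHolomorphicOneForm (InoueData.model n) l → l = 0) ∧
    (∀ k : ℕ, 0 < k → ComplexManifold.pluricanonicalSections (InoueData.model n) D.TM k = ⊥) ∧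
    ComplexManifold.kodairaDimension (InoueData.model n) D.TM = ⊥ :=
  ⟨fun _ hl ↦ D.eq_zero_of_isHolomorphicOneForm hl,
    fun _ hk ↦ D.pluricanonicalSections_eq_bot hk, D.kodairaDimension_eq_bot⟩
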